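/- Let $q$ be a prime power and let $r$ be a positive integer with $r\mid q-1$. For positive integers $n,r$ put $Z_{n,r}=\{1+ir:0\le i\le n-1\}$, a subset of the residues $\{1,2,\dots,nr\}$ modulo $nr$. The $q$-cyclotomic coset modulo $nr$ of $i$ is the set of residues of $iq^j$ ($j\ge 0$), and its smallest element is its leader. Let $N_l$ be the number of $q$-cyclotomic cosets of size $l$ generated by elements of $Z_{n,r}$; list these cosets by increasing leader. A $\lambda$-constacyclic code of length $n$ is a linear code $\mathcal C\subseteq\mathbb F_q^n$ with $(\lambda c_{n-1},c_0,\dots,c_{n-2})\in\mathcal C$ whenever $(c_0,\dots,c_{n-1})\in\mathcal C$. If $\beta$ is a primitive $nr$-th root of unity in $\overline{\mathbb F}_q$ with $\beta^n=\lambda$, the defining set of $\mathcal C$ with respect to $\beta$ is the set of all $i\in Z_{n,r}$ such that $\beta^i$ is a zero of the generator polynomial of $\mathcal C$ (equivalently, of every codeword polynomial $c_0+c_1x+\dots+c_{n-1}x^{n-1}$). An $[n,k,\ge d]$ code is a linear code of length $n$ and dimension $k$ in which any two distinct codewords differ in at least $d$ positions. **Theorem.** (a) Let $p$ be a prime and $n,s$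 positive integers with $nr=(q^p-1)/s$ and $\gcd\bigl(r,\,nr/\gcd(nr,q-1)\bigr)=1$. Then $$N_1=\gcd\bigl(n,(q-1)/r\bigr),\qquad N_p=\frac{n-\gcd\bigl(n,(q-1)/r\bigr)}{p}.$$ Let $\lambda\in\mathbb F_q^*$ have multiplicative order $r$. Then there is a primitive $nr$-th root of unity $\beta\in\overline{\mathbb F}_q$ with $\beta^n=\lambda$, and for every such $\beta$ the following hold. The $\lambda$-constacyclic code whose defining set is the union of the first $\lceil N_1/2\rceil$ cosets of size $1$ and the first $\lceil N_p/2\rceil$ cosets of size $p$ in $Z_{n,r}$ exists and has parameters $$\Bigl[n,\ n-\lceil N_1/2\rceil-p\lceil N_p/2\rceil,\ \ge\Bigl\lceil\frac{q\lceil N_p/2\rceil}{q-1}\Bigr\rceil+\Lambda_p\Bigr],\qquad \Lambda_p=\Bigl\lceil\frac{q|S_p|}{q-1}\Bigr\rceil-1,$$ where $S_p$ is the set of all triples $(i,j,t)$ of non-negative integers with $$\tfrac{p+1}{2}\le i\le\lfloor p-\log_q(s+1)\rfloor,\quad 1\le j\le q-1,\quad 0\le t<\frac{q^i-j(q^{p-i}-1)-1}{q^{p-i+1}-q},$$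 $$q^i+qt+j\equiv1\pmod r,\qquad q^i+qt+j\le 1+\Bigl(\Bigl\lceil\frac{q\lceil N_p/2\rceil}{q-1}\Bigr\rceil-2\Bigr)r.$$ If moreover (1) $N_1>1$, or (2) $N_1=1$ and $2p(q-1)\ge qr$, or (3) $r\le3$, then the $\lambda$-constacyclic code whose defining set is the union of the first $\lfloor N_1/2\rfloor$ cosets of size $1$ and the first $\lfloor N_p/2\rfloor$ cosets of size $p$ in $Z_{n,r}$ exists and has parameters $$\Bigl[n,\ n-\lfloor N_1/2\rfloor-p\lfloor N_p/2\rfloor,\ \ge\Bigl\lfloor\frac{qN_p}{2(q-1)}\Bigr\rfloor\Bigr].$$ (b) Both families are infinite: for every such $q$ and $r$ there are infinitely many lengths $n$ for which some prime $p$ and positive integer $s$ satisfy the hypotheses of (a) together with one of (1), (2), (3). -/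

import Mathlib

/-- `Z_{n,r} = {1, 1 + r, …, 1 + (n-1) r}`, inside the residues `{1, …, n r}` modulo `n r`. -/
def zSet (n r : ℕ) : Finset ℕ :=
  (Finset.range n).image fun k => 1 + k * r

open Classical in
/-- The `q`-cyclotomic coset of `i` modulo `M`, with residues represented by `1, …, M`. -/
noncomputable def cycCoset (q M i : ℕ) : Finset ℕ :=
  (Finset.Icc 1 M).filter fun x => ∃ j : ℕ, x ≡ i * q ^ j [MOD M]

/-- `N_l`: the number of `q`-cyclotomic cosets modulo `n r` of size `l` generated by elements
of `Z_{n,r}`. -/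
noncomputable def numCosets (q n r l : ℕ) : ℕ :=
  (((zSet n r).image (cycCoset q (n * r))).filter fun C => C.card = l).card

open Classical in
/-- The coset leaders (smallest elements of their cosets) in `Z_{n,r}` of the cosets of
size `l`. -/
noncomputable def cosetLeaders (q n r l : ℕ) : Finset ℕ :=
  (zSet n r).filter fun i =>
    (cycCoset q (n * r) i).card = l ∧ ∀ x ∈ cycCoset q (n * r) i, i ≤ x

open Classical in
/-- The union of the first `k` cosets of size `l` contained in `Z_{n,r}`, where the cosets are
listed in ascending order of their leaders. -/
noncomputable def firstCosets (q n r l k : ℕ) : Finset ℕ :=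
  ((cosetLeaders q n r l).filter fun i =>
    ((cosetLeaders q n r l).filter fun j => j < i).card < k).biUnion (cycCoset q (n * r))

/-- The `lam`-constacyclic shift `(c_0, …, c_{n-1}) ↦ (lam c_{n-1}, c_0, …, c_{n-2})`. -/
def constaShift {F : Type*} [Field F] {n : ℕ} (lam : F) (c : Fin n → F) : Fin n → F :=
  fun j =>
    if (j : ℕ) = 0 then lam * c ⟨n - 1, Nat.sub_lt (Nat.zero_lt_of_lt j.isLt) Nat.one_pos⟩
    else c ⟨(j : ℕ) - 1, lt_of_le_of_lt (Nat.sub_le _ _) j.isLt⟩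

/-- A linear code closed under the `lam`-constacyclic shift. -/
def IsConstacyclic {F : Type*} [Field F] {n : ℕ} (lam : F)
    (C : Submodule F (Fin n → F)) : Prop :=
  ∀ c ∈ C, constaShift lam c ∈ C

/-- The defining set with respect to `β`: all `i ∈ Z_{n,r}` such that `β ^ i` is a root of the
generator polynomial, that is, a common root of all the codewords `c_0 + c_1 x + ⋯`. -/
def definingSet {F K : Type*} [Field F] [Field K] [Algebra F K] {n : ℕ} (r : ℕ) (β : K)
    (C : Submodule F (Fin n → F)) : Set ℕ :=
  {i | i ∈ zSet n r ∧ ∀ c ∈ C, ∑ j : Fin n, algebraMap F K (c j) * (β ^ i) ^ (j : ℕ) = 0}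

/-- `C` is an `[n, k, ≥ d]` linear code: it has dimension `k`, and any two distinct codewords
differ in at least `d` positions. -/
def HasParams {F : Type*} [Field F] [DecidableEq F] {n : ℕ} (C : Submodule F (Fin n → F))
    (k d : ℤ) : Prop :=
  (Module.finrank F C : ℤ) = k ∧
    ∀ x ∈ C, ∀ y ∈ C, x ≠ y → d ≤ (hammingDist x y : ℤ)

/-- The set `S_m` of triples `(i, j, t)`; the argument `h` stands for `⌈N_m / 2⌉`. -/
def sSet (q m s r h : ℕ) : Set (ℕ × ℕ × ℕ) :=
  {x | match x with
    | (i, j, t) =>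
      ((m : ℝ) + 1) / 2 ≤ i ∧ (i : ℤ) ≤ ⌊(m : ℝ) - Real.logb q ((s : ℝ) + 1)⌋ ∧
      1 ≤ j ∧ j ≤ q - 1 ∧
      (t : ℝ) < ((q : ℝ) ^ i - j * ((q : ℝ) ^ (m - i) - 1) - 1) / ((q : ℝ) ^ (m - i + 1) - q) ∧
      q ^ i + q * t + j ≡ 1 [MOD r] ∧
      ((q ^ i + q * t + j : ℕ) : ℤ) ≤ 1 + (⌈(q : ℚ) * h / ((q : ℚ) - 1)⌉ - 2) * r}

/-- `Λ_m = ⌈q |S_m| / (q - 1)⌉ - 1`. -/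
noncomputable def lambdaTerm (q m s r h : ℕ) : ℤ :=
  ⌈(q : ℚ) * (sSet q m s r h).ncard / ((q : ℚ) - 1)⌉ - 1

/-! The numbers `β ^ (1 + k * r)` form a geometric progression whose ratio `β ^ r` has order `n`. By
the BCH bound (`lt_card_support_of_forall_eq_zero`), a defining set `T` containing `1 + m * r` for
all `m < k` forces distance at least `k + 1`. Everything thus reduces to showing that the first
residue `1 + k * r` missing from `T` comes late. As `T` is a union of cosets, that residue is a
coset leader (`mem_cosetLeaders_of_first_missing`), and its coset has size 1 or `p`, because
multiplication by `q` has period dividing the prime `p`.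

If the size is `p`, all chosen leaders of size `p` lie before `1 + k * r`. A leader is never a
multiple of `q`, since `x / q` is in the coset of `x`; and because `q ≡ 1` modulo `r`, at least `⌊k
/ q⌋` of the first `k` elements of `Z_{n,r}` are multiples of `q`. The triples of `S_p` encode
further elements that are neither leaders nor multiples of `q`. With `h = ⌈N_p / 2⌉` this gives `h +
|S_p| + ⌊k / q⌋ ≤ k`, the source of the factor `q / (q - 1)`. The rounded-down code is treated
likewise, without `S_p`.

If the size is 1, the coprimality hypothesis places the fixed points in a single class modulo `m *
r`, where `m = n * r / gcd (n * r, q - 1)` and `m * N_1 = n`. They are equally spaced, so an omitted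
one of rank `A` has `k ≥ A * m`, and crude estimates with `n = N_1 + p * N_p` suffice. The exception
is `N_1 = 1` with rounding down: no fixed point is chosen, and conditions (2) and (3) control how
early it can occur.

For (b), take `s = 1` and primes `p > q`. -/

/-! ### Cyclotomic cosets and their leaders in `Z_{n,r}` -/

theorem mem_zSet_iff {n r x : ℕ} (hr : 0 < r) :
    x ∈ zSet n r ↔ 1 ≤ x ∧ x ≤ n * r ∧ x ≡ 1 [MOD r] := by
  unfold zSet
  simp only [Finset.mem_image, Finset.mem_range]
  constructor
  · rintro ⟨k, hk, rfl⟩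
    refine ⟨by omega, ?_, ?_⟩
    · have : (k + 1) * r ≤ n * r := Nat.mul_le_mul_right _ hk
      nlinarith
    · simp [Nat.ModEq]
  · rintro ⟨h1, h2, h3⟩
    have h4 : r ∣ x - 1 := (Nat.modEq_iff_dvd' h1).1 h3.symm
    obtain ⟨k, hk⟩ := h4
    refine ⟨k, ?_, ?_⟩
    · by_contra hkn
      have : r * n ≤ r * k := Nat.mul_le_mul_left _ (by omega)
      have : r * n = n * r := mul_comm _ _
      omega
    · have : r * k = k * r := mul_comm _ _
      omega

theorem card_zSet {n r : ℕ} (hr : 0 < r) : (zSet n r).card = n := by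
  unfold zSet
  rw [Finset.card_image_of_injective, Finset.card_range]
  intro a b hab
  simpa [hr.ne'] using hab

theorem mem_cycCoset {q M i x : ℕ} :
    x ∈ cycCoset q M i ↔ (1 ≤ x ∧ x ≤ M) ∧ ∃ j : ℕ, x ≡ i * q ^ j [MOD M] := by
  simp [cycCoset]

theorem self_mem_cycCoset {q M i : ℕ} (h1 : 1 ≤ i) (h2 : i ≤ M) : i ∈ cycCoset q M i :=
  mem_cycCoset.2 ⟨⟨h1, h2⟩, 0, by simp [Nat.ModEq]⟩

theorem pow_modEq_one_of_dvd {q M p : ℕ} (hq : 0 < q) (hM : M ∣ q ^ p - 1) :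
    q ^ p ≡ 1 [MOD M] :=
  ((Nat.modEq_iff_dvd' (Nat.one_le_pow _ _ hq)).2 hM).symm

/-- Since `q ^ p ≡ 1`, the power `q ^ ((p - 1) * j)` inverts `q ^ j`; hence lying in a common coset
is symmetric. -/
theorem modEq_mul_pow_symm {q M p i x j : ℕ} (hp : 0 < p) (hq : 0 < q) (hM : M ∣ q ^ p - 1)
    (h : x ≡ i * q ^ j [MOD M]) : i ≡ x * q ^ ((p - 1) * j) [MOD M] := by
  have h1 : x * q ^ ((p - 1) * j) ≡ i * q ^ j * q ^ ((p - 1) * j) [MOD M] := h.mul_right _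
  have h2 : i * q ^ j * q ^ ((p - 1) * j) = i * (q ^ p) ^ j := by
    rw [mul_assoc, ← pow_add, ← pow_mul]
    obtain ⟨p, rfl⟩ : ∃ p', p = p' + 1 := ⟨p - 1, by omega⟩
    simp only [Nat.add_sub_cancel]
    ring_nf
  rw [h2] at h1
  have h3 : i * (q ^ p) ^ j ≡ i * 1 ^ j [MOD M] :=
    ((pow_modEq_one_of_dvd hq hM).pow j).mul_left i
  simpa using (h1.trans h3).symm

theorem cycCoset_eq_of_mem {q M p i x : ℕ} (hp : 0 < p) (hq : 0 < q) (hM : M ∣ q ^ p - 1)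
    (h : x ∈ cycCoset q M i) : cycCoset q M x = cycCoset q M i := by
  obtain ⟨-, j, hj⟩ := mem_cycCoset.1 h
  have hi := modEq_mul_pow_symm hp hq hM hj
  ext y
  simp only [mem_cycCoset]
  constructor
  · rintro ⟨hy, k, hk⟩
    refine ⟨hy, j + k, hk.trans ?_⟩
    rw [pow_add, ← mul_assoc]
    exact hj.mul_right _
  · rintro ⟨hy, k, hk⟩
    refine ⟨hy, (p - 1) * j + k, hk.trans ?_⟩
    rw [pow_add, ← mul_assoc]
    exact hi.mul_right _

theorem cycCoset_subset_zSet {q n r i : ℕ} (hr : 0 < r) (hq : q ≡ 1 [MOD r])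
    (hi : i ∈ zSet n r) : cycCoset q (n * r) i ⊆ zSet n r := by
  intro x hx
  obtain ⟨hx1, j, hj⟩ := mem_cycCoset.1 hx
  rw [mem_zSet_iff hr] at hi ⊢
  refine ⟨hx1.1, hx1.2, ?_⟩
  have h1 : x ≡ i * q ^ j [MOD r] := hj.of_dvd (dvd_mul_left _ _)
  have h2 : i * q ^ j ≡ 1 * 1 ^ j [MOD r] := hi.2.2.mul (hq.pow j)
  simpa using h1.trans h2

theorem mem_cosetLeaders {q n r l i : ℕ} : i ∈ cosetLeaders q n r l ↔
    i ∈ zSet n r ∧ (cycCoset q (n * r) i).card = l ∧ ∀ x ∈ cycCoset q (n * r) i, i ≤ x := by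
  simp [cosetLeaders]

theorem exists_cosetLeader {q n r p i : ℕ} (hr : 0 < r) (hqr : q ≡ 1 [MOD r]) (hp : 0 < p)
    (hq : 0 < q) (hM : n * r ∣ q ^ p - 1) (hi : i ∈ zSet n r) :
    ∃ x ∈ cosetLeaders q n r (cycCoset q (n * r) i).card,
      x ∈ cycCoset q (n * r) i ∧ cycCoset q (n * r) x = cycCoset q (n * r) i := by
  have hi' := (mem_zSet_iff hr).1 hi
  have hne : (cycCoset q (n * r) i).Nonempty := ⟨i, self_mem_cycCoset hi'.1 hi'.2.1⟩
  have hmem := Finset.min'_mem _ hne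
  have heq := cycCoset_eq_of_mem hp hq hM hmem
  refine ⟨_, mem_cosetLeaders.2 ⟨cycCoset_subset_zSet hr hqr hi hmem, by rw [heq], ?_⟩, hmem, heq⟩
  intro x hx
  rw [heq] at hx
  exact Finset.min'_le _ _ hx

theorem eq_of_mem_cycCoset_cosetLeaders {q n r p l l' i j x : ℕ} (hr : 0 < r) (hp : 0 < p)
    (hq : 0 < q) (hM : n * r ∣ q ^ p - 1) (hi : i ∈ cosetLeaders q n r l)
    (hj : j ∈ cosetLeaders q n r l') (hxi : x ∈ cycCoset q (n * r) i)
    (hxj : x ∈ cycCoset q (n * r) j) : i = j := by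
  rw [mem_cosetLeaders] at hi hj
  have h := (cycCoset_eq_of_mem hp hq hM hxi).symm.trans (cycCoset_eq_of_mem hp hq hM hxj)
  have hi' := (mem_zSet_iff hr).1 hi.1
  have hj' := (mem_zSet_iff hr).1 hj.1
  refine le_antisymm (hi.2.2 j ?_) (hj.2.2 i ?_)
  · rw [h]; exact self_mem_cycCoset hj'.1 hj'.2.1
  · rw [← h]; exact self_mem_cycCoset hi'.1 hi'.2.1

theorem numCosets_eq_card_cosetLeaders {q n r p l : ℕ} (hr : 0 < r) (hqr : q ≡ 1 [MOD r])
    (hp : 0 < p) (hq : 0 < q) (hM : n * r ∣ q ^ p - 1) :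
    numCosets q n r l = (cosetLeaders q n r l).card := by
  unfold numCosets
  rw [← Finset.card_image_of_injOn (s := cosetLeaders q n r l) (f := cycCoset q (n * r))]
  · congr 1
    ext C
    simp only [Finset.mem_filter, Finset.mem_image]
    constructor
    · rintro ⟨⟨i, hi, rfl⟩, hl⟩
      obtain ⟨x, hx, -, he⟩ := exists_cosetLeader hr hqr hp hq hM hi
      exact ⟨x, hl ▸ hx, he⟩
    · rintro ⟨i, hi, rfl⟩
      rw [mem_cosetLeaders] at hi
      exact ⟨⟨i, hi.1, rfl⟩, hi.2.1⟩
  · intro i hi j hj hij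
    have hi1 := (mem_zSet_iff hr).1 (mem_cosetLeaders.1 hi).1
    have hs := self_mem_cycCoset (q := q) hi1.1 hi1.2.1
    exact eq_of_mem_cycCoset_cosetLeaders hr hp hq hM hi hj hs (hij ▸ hs)

/-- The rank of an element, the number of smaller elements, maps `s` bijectively onto `range
s.card`. -/
theorem card_filter_rank_lt (s : Finset ℕ) {k : ℕ} (hk : k ≤ s.card) :
    (s.filter fun i => (s.filter fun j => j < i).card < k).card = k := by
  have hinj : Set.InjOn (fun i => (s.filter fun j => j < i).card) s := by
    have key : ∀ a ∈ s, ∀ b ∈ s, a < b →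
        (s.filter fun j => j < a).card < (s.filter fun j => j < b).card := by
      intro a ha b _ hab
      apply Finset.card_lt_card
      refine Finset.ssubset_iff_of_subset ?_ |>.2 ⟨a, by simp [ha, hab], by simp⟩
      intro x hx
      simp only [Finset.mem_filter] at hx ⊢
      exact ⟨hx.1, hx.2.trans hab⟩
    intro a ha b hb hab
    rcases lt_trichotomy a b with h | h | h
    · exact absurd hab (key a ha b hb h).ne
    · exact h
    · exact absurd hab (key b hb a ha h).ne'
  have himg : s.image (fun i => (s.filter fun j => j < i).card) = Finset.range s.card := by
    apply Finset.eq_of_subset_of_card_le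
    · intro m hm
      obtain ⟨i, hi, rfl⟩ := Finset.mem_image.1 hm
      rw [Finset.mem_range]
      apply Finset.card_lt_card
      exact Finset.ssubset_iff_of_subset (Finset.filter_subset _ _) |>.2 ⟨i, hi, by simp⟩
    · rw [Finset.card_range, Finset.card_image_of_injOn hinj]
  rw [← Finset.card_image_of_injOn (hinj.mono (fun x hx => (Finset.mem_filter.1 hx).1))]
  have : (s.filter fun i => (s.filter fun j => j < i).card < k).image
      (fun i => (s.filter fun j => j < i).card) = Finset.range k := by
    ext m
    simp only [Finset.mem_image, Finset.mem_filter, Finset.mem_range]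
    constructor
    · rintro ⟨a, ⟨_, h⟩, rfl⟩
      exact h
    · intro hm
      have : m ∈ s.image (fun i => (s.filter fun j => j < i).card) := by
        rw [himg, Finset.mem_range]; omega
      obtain ⟨a, ha, hma⟩ := Finset.mem_image.1 this
      exact ⟨a, ⟨ha, by omega⟩, hma⟩
  rw [this, Finset.card_range]

theorem mem_firstCosets {q n r l k x : ℕ} : x ∈ firstCosets q n r l k ↔
    ∃ i ∈ cosetLeaders q n r l, ((cosetLeaders q n r l).filter fun j => j < i).card < k ∧
      x ∈ cycCoset q (n * r) i := by
  simp [firstCosets, and_assoc]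

theorem card_firstCosets {q n r p l k : ℕ} (hr : 0 < r) (hp : 0 < p)
    (hq : 0 < q) (hM : n * r ∣ q ^ p - 1) (hk : k ≤ (cosetLeaders q n r l).card) :
    (firstCosets q n r l k).card = k * l := by
  unfold firstCosets
  rw [Finset.card_biUnion]
  · rw [Finset.sum_const_nat (m := l), card_filter_rank_lt _ hk]
    intro i hi
    exact (mem_cosetLeaders.1 (Finset.mem_filter.1 hi).1).2.1
  · intro i hi j hj hij
    rw [Function.onFun, Finset.disjoint_left]
    intro x hxi hxj
    exact hij (eq_of_mem_cycCoset_cosetLeaders hr hp hq hM (Finset.mem_filter.1 hi).1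
      (Finset.mem_filter.1 hj).1 hxi hxj)

theorem disjoint_firstCosets {q n r p l l' k k' : ℕ} (hr : 0 < r) (hp : 0 < p)
    (hq : 0 < q) (hM : n * r ∣ q ^ p - 1) (hl : l ≠ l') :
    Disjoint (firstCosets q n r l k) (firstCosets q n r l' k') := by
  rw [Finset.disjoint_left]
  intro x hx hx'
  obtain ⟨i, hi, -, hxi⟩ := mem_firstCosets.1 hx
  obtain ⟨j, hj, -, hxj⟩ := mem_firstCosets.1 hx'
  obtain rfl := eq_of_mem_cycCoset_cosetLeaders hr hp hq hM hi hj hxi hxj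
  exact hl ((mem_cosetLeaders.1 hi).2.1.symm.trans (mem_cosetLeaders.1 hj).2.1)

theorem cycCoset_subset_firstCosets {q n r p l k x : ℕ} (hp : 0 < p)
    (hq : 0 < q) (hM : n * r ∣ q ^ p - 1) (hx : x ∈ firstCosets q n r l k) :
    cycCoset q (n * r) x ⊆ firstCosets q n r l k := by
  obtain ⟨i, hi, hk, hxi⟩ := mem_firstCosets.1 hx
  rw [cycCoset_eq_of_mem hp hq hM hxi]
  exact fun y hy => mem_firstCosets.2 ⟨i, hi, hk, hy⟩

theorem firstCosets_subset_zSet {q n r l k : ℕ} (hr : 0 < r) (hqr : q ≡ 1 [MOD r]) :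
    firstCosets q n r l k ⊆ zSet n r := by
  intro x hx
  obtain ⟨i, hi, -, hxi⟩ := mem_firstCosets.1 hx
  exact cycCoset_subset_zSet hr hqr (mem_cosetLeaders.1 hi).1 hxi

theorem le_card_of_not_mem_firstCosets {q n r l k x : ℕ} (hr : 0 < r)
    (hx : x ∈ cosetLeaders q n r l) (hxT : x ∉ firstCosets q n r l k) :
    k ≤ ((cosetLeaders q n r l).filter fun j => j < x).card := by
  by_contra h
  have hx' := (mem_zSet_iff hr).1 (mem_cosetLeaders.1 hx).1
  exact hxT (mem_firstCosets.2 ⟨x, hx, by omega, self_mem_cycCoset hx'.1 hx'.2.1⟩)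

/-- The coset is the orbit of `i` in `ZMod M` under multiplication by `q`. Its length is the minimal
period, which divides the prime `p`, and it equals 1 exactly when `i * q = i`. -/
theorem card_cycCoset {q M p i : ℕ} (hp : p.Prime) (hq : 0 < q) (hM0 : 0 < M)
    (hM : M ∣ q ^ p - 1) :
    ((cycCoset q M i).card = 1 ∧ M ∣ i * (q - 1)) ∨
      ((cycCoset q M i).card = p ∧ ¬ M ∣ i * (q - 1)) := by
  have : NeZero M := ⟨hM0.ne'⟩
  set f : ZMod M → ZMod M := fun x => x * q with hf
  have hfj : ∀ j, f^[j] (i : ZMod M) = i * q ^ j := by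
    intro j
    induction j with
    | zero => simp
    | succ j ih => rw [Function.iterate_succ_apply', ih, hf]; simp only; ring
  have hper : Function.IsPeriodicPt f p (i : ZMod M) := by
    rw [Function.IsPeriodicPt, Function.IsFixedPt, hfj]
    have : ((q ^ p : ℕ) : ZMod M) = (1 : ℕ) :=
      (ZMod.natCast_eq_natCast_iff _ _ _).2 (pow_modEq_one_of_dvd hq hM)
    push_cast at this
    rw [this, mul_one]
  have hcard : (cycCoset q M i).card = Function.minimalPeriod f (i : ZMod M) := by
    have hpos : 0 < Function.minimalPeriod f (i : ZMod M) :=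
      hper.minimalPeriod_pos hp.pos
    have h1 : ((cycCoset q M i).image (fun x : ℕ => (x : ZMod M))).card
        = (cycCoset q M i).card := by
      apply Finset.card_image_of_injOn
      intro a ha b hb hab
      have ha' := (mem_cycCoset.1 ha).1
      have hb' := (mem_cycCoset.1 hb).1
      have hab' := (ZMod.natCast_eq_natCast_iff _ _ _).1 hab
      rcases le_total a b with h | h
      · have h2 := (Nat.modEq_iff_dvd' h).1 hab'
        by_contra hne
        have := Nat.le_of_dvd (by omega) h2
        omega
      · have h2 := (Nat.modEq_iff_dvd' h).1 hab'.symm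
        by_contra hne
        have := Nat.le_of_dvd (by omega) h2
        omega
    have h2 : (cycCoset q M i).image (fun x : ℕ => (x : ZMod M)) =
        (Finset.range (Function.minimalPeriod f (i : ZMod M))).image
          (fun j => f^[j] (i : ZMod M)) := by
      ext z
      simp only [Finset.mem_image, Finset.mem_range, mem_cycCoset]
      constructor
      · rintro ⟨x, ⟨-, j, hj⟩, rfl⟩
        refine ⟨j % Function.minimalPeriod f (i : ZMod M), Nat.mod_lt _ hpos, ?_⟩
        rw [Function.iterate_mod_minimalPeriod_eq, hfj]
        have := (ZMod.natCast_eq_natCast_iff _ _ _).2 hj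
        push_cast at this
        exact this.symm
      · rintro ⟨j, -, rfl⟩
        -- Representatives run over `1, …, M`, so the zero class is represented by `M`.
        have hz : ∀ z : ZMod M, ∃ x : ℕ, (1 ≤ x ∧ x ≤ M) ∧ (x : ZMod M) = z := by
          intro z
          by_cases h0 : z = 0
          · exact ⟨M, ⟨hM0, le_rfl⟩, by simp [h0]⟩
          · refine ⟨z.val, ⟨?_, (ZMod.val_lt z).le⟩, by simp⟩
            have : z.val ≠ 0 := by simpa [ZMod.val_eq_zero] using h0
            omega
        obtain ⟨x, hx, hxz⟩ := hz (f^[j] (i : ZMod M))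
        refine ⟨x, ⟨hx, j, ?_⟩, hxz⟩
        rw [← ZMod.natCast_eq_natCast_iff, hxz, hfj]
        push_cast
        rfl
    rw [← h1, h2, Finset.card_image_of_injOn, Finset.card_range]
    intro a ha b hb hab
    exact Function.iterate_injOn_Iio_minimalPeriod (by simpa using ha) (by simpa using hb) hab
  have hone : Function.minimalPeriod f (i : ZMod M) = 1 ↔ M ∣ i * (q - 1) := by
    rw [Function.minimalPeriod_eq_one_iff_isFixedPt, Function.IsFixedPt, hf]
    simp only
    have : ((i : ZMod M) * q = i) ↔ ((i * q : ℕ) : ZMod M) = (i : ℕ) := by push_cast; rfl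
    rw [this, ZMod.natCast_eq_natCast_iff]
    rw [Nat.mul_sub, mul_one]
    constructor
    · intro h
      exact (Nat.modEq_iff_dvd' (Nat.le_mul_of_pos_right _ hq)).1 h.symm
    · intro h
      exact ((Nat.modEq_iff_dvd' (Nat.le_mul_of_pos_right _ hq)).2 h).symm
  rw [hcard, ← hone]
  rcases (Nat.dvd_prime hp).1 hper.minimalPeriod_dvd with h | h
  · exact Or.inl ⟨h, h⟩
  · refine Or.inr ⟨h, ?_⟩
    rw [h]; exact hp.one_lt.ne'

theorem card_cosetLeaders_add {q n r p : ℕ} (hr : 0 < r) (hqr : q ≡ 1 [MOD r]) (hp : p.Prime)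
    (hq : 0 < q) (hn : 0 < n) (hM : n * r ∣ q ^ p - 1) :
    n = (cosetLeaders q n r 1).card + p * (cosetLeaders q n r p).card := by
  have hZ : zSet n r = firstCosets q n r 1 (cosetLeaders q n r 1).card ∪
      firstCosets q n r p (cosetLeaders q n r p).card := by
    apply Finset.Subset.antisymm
    · intro x hx
      obtain ⟨y, hy, -, he⟩ := exists_cosetLeader hr hqr hp.pos hq hM hx
      have hx' := (mem_zSet_iff hr).1 hx
      have hxy : x ∈ cycCoset q (n * r) y := he ▸ self_mem_cycCoset hx'.1 hx'.2.1
      have hrank : ∀ l, y ∈ cosetLeaders q n r l →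
          x ∈ firstCosets q n r l (cosetLeaders q n r l).card := by
        intro l hl
        refine mem_firstCosets.2 ⟨y, hl, ?_, hxy⟩
        apply Finset.card_lt_card
        exact Finset.ssubset_iff_of_subset (Finset.filter_subset _ _) |>.2 ⟨y, hl, by simp⟩
      rw [Finset.mem_union]
      rcases card_cycCoset (i := x) hp hq (Nat.mul_pos hn hr) hM with ⟨h, -⟩ | ⟨h, -⟩
      · rw [h] at hy; exact Or.inl (hrank _ hy)
      · rw [h] at hy; exact Or.inr (hrank _ hy)
    · exact Finset.union_subset (firstCosets_subset_zSet hr hqr) (firstCosets_subset_zSet hr hqr)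
  have h := congrArg Finset.card hZ
  rw [card_zSet hr, Finset.card_union_of_disjoint
    (disjoint_firstCosets hr hp.pos hq hM hp.one_lt.ne),
    card_firstCosets hr hp.pos hq hM le_rfl, card_firstCosets hr hp.pos hq hM le_rfl] at h
  rw [mul_one] at h
  rw [mul_comm p]
  exact h

/-! ### Codes prescribed by their zeros, and the BCH bound -/

theorem IsPrimitiveRoot.pow_eq_pow_of_modEq {M : Type*} [CommMonoid M] {ζ : M} {k a b : ℕ}
    (hζ : IsPrimitiveRoot ζ k) (h : a ≡ b [MOD k]) : ζ ^ a = ζ ^ b := by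
  rw [← pow_mod_orderOf ζ a, ← pow_mod_orderOf ζ b, ← hζ.eq_orderOf, h]

/-- The image of `F` already supplies as many roots of `X ^ |F| - X` as its degree allows. -/
theorem exists_algebraMap_eq_of_pow_card_eq {F K : Type*} [Field F] [Fintype F] [Field K]
    [Algebra F K] {a : K} (ha : a ^ Fintype.card F = a) : ∃ b : F, algebraMap F K b = a := by
  classical
  by_contra! h
  set P : Polynomial K := Polynomial.X ^ Fintype.card F - Polynomial.X with hP
  have hd : P.natDegree = Fintype.card F :=
    FiniteField.X_pow_card_sub_X_natDegree_eq K Fintype.one_lt_card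
  have h0 : P ≠ 0 := FiniteField.X_pow_card_sub_X_ne_zero K Fintype.one_lt_card
  have hsub : (insert a (Finset.univ.image (algebraMap F K))).val ⊆ P.roots := by
    intro x hx
    rw [Polynomial.mem_roots h0, Polynomial.IsRoot.def, hP]
    rw [Finset.mem_val, Finset.mem_insert, Finset.mem_image] at hx
    rcases hx with rfl | ⟨b, -, rfl⟩
    · simp [ha]
    · simp [← map_pow, FiniteField.pow_card]
  have h1 := Polynomial.card_le_degree_of_subset_roots hsub
  rw [Finset.card_insert_of_notMem, Finset.card_image_of_injective _ (algebraMap F K).injective,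
    hd, Finset.card_univ] at h1
  · omega
  · simp only [Finset.mem_image, Finset.mem_univ, true_and, not_exists]
    exact h

/-- Frobenius is injective, so it permutes the finite set `R` and fixes every coefficient of the
product; the coefficients therefore descend to `F`. -/
theorem exists_map_eq_prod_X_sub_C {F K : Type*} [Field F] [Fintype F] [Field K]
    [Algebra F K] (R : Finset K) (hR : ∀ a ∈ R, a ^ Fintype.card F ∈ R) :
    ∃ g : Polynomial F, g.map (algebraMap F K) = ∏ a ∈ R, (Polynomial.X - Polynomial.C a) := by
  classical
  let φ : K →+* K := (FiniteField.frobeniusAlgHom F K).toRingHom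
  have hφa : ∀ a, φ a = a ^ Fintype.card F := fun a => rfl
  have himg : R.image φ = R := by
    apply Finset.eq_of_subset_of_card_le
    · intro x hx
      obtain ⟨a, ha, rfl⟩ := Finset.mem_image.1 hx
      exact hR a ha
    · rw [Finset.card_image_of_injective _ φ.injective]
  have hfix : (∏ a ∈ R, (Polynomial.X - Polynomial.C a)).map φ =
      ∏ a ∈ R, (Polynomial.X - Polynomial.C a) := by
    rw [Polynomial.map_prod]
    conv_rhs => rw [← himg, Finset.prod_image φ.injective.injOn]
    simp
  have hl : (∏ a ∈ R, (Polynomial.X - Polynomial.C a)) ∈ Polynomial.lifts (algebraMap F K) := by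
    rw [Polynomial.lifts_iff_coeff_lifts]
    intro k
    apply exists_algebraMap_eq_of_pow_card_eq
    rw [← hφa, ← Polynomial.coeff_map, hfix]
  exact (Polynomial.mem_lifts _).1 hl

/-- The codeword polynomial `c_0 + c_1 x + ⋯ + c_{n-1} x^{n-1}`. -/
noncomputable def codePoly {F : Type*} [Field F] (n : ℕ) : (Fin n → F) →ₗ[F] Polynomial F :=
  ∑ j : Fin n, (Polynomial.monomial (j : ℕ)).comp (LinearMap.proj j)

section

variable {F : Type*} [Field F] {n : ℕ}

theorem codePoly_apply (c : Fin n → F) :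
    codePoly n c = ∑ j : Fin n, Polynomial.monomial (j : ℕ) (c j) := by
  simp [codePoly]

theorem coeff_codePoly (c : Fin n → F) (j : Fin n) : (codePoly n c).coeff j = c j := by
  rw [codePoly_apply, Polynomial.finsetSum_coeff]
  simp [Polynomial.coeff_monomial, Fin.val_inj]

theorem degree_codePoly_lt (c : Fin n → F) : (codePoly n c).degree < n := by
  rw [Polynomial.degree_lt_iff_coeff_zero]
  intro m hm
  rw [codePoly_apply, Polynomial.finsetSum_coeff]
  apply Finset.sum_eq_zero
  intro j _
  rw [Polynomial.coeff_monomial, if_neg]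
  omega

theorem codePoly_coeff {P : Polynomial F} (hP : P.degree < n) :
    codePoly n (fun j => P.coeff j) = P := by
  ext m
  by_cases hm : m < n
  · exact coeff_codePoly _ ⟨m, hm⟩
  · rw [Polynomial.coeff_eq_zero_of_degree_lt (hP.trans_le (by exact_mod_cast not_lt.1 hm)),
      Polynomial.coeff_eq_zero_of_degree_lt
        ((degree_codePoly_lt _).trans_le (by exact_mod_cast not_lt.1 hm))]

theorem codePoly_injective : Function.Injective (codePoly (F := F) n) := by
  intro c d h
  ext j
  rw [← coeff_codePoly c j, h, coeff_codePoly]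

theorem aeval_codePoly {K : Type*} [Field K] [Algebra F K] (c : Fin n → F) (x : K) :
    Polynomial.aeval x (codePoly n c) = ∑ j : Fin n, algebraMap F K (c j) * x ^ (j : ℕ) := by
  rw [codePoly_apply, map_sum]
  simp [Polynomial.aeval_monomial]

/-- The code of all words whose polynomial vanishes on a set `R` of an extension field. -/
def zeroCode {K : Type*} [Field K] [Algebra F K] (n : ℕ) (R : Set K) :
    Submodule F (Fin n → F) where
  carrier := {c | ∀ a ∈ R, ∑ j : Fin n, algebraMap F K (c j) * a ^ (j : ℕ) = 0}
  add_mem' := by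
    intro c d hc hd a ha
    simp [add_mul, Finset.sum_add_distrib, hc a ha, hd a ha]
  zero_mem' := by intro a _; simp
  smul_mem' := by
    intro k c hc a ha
    simp [mul_assoc, ← Finset.mul_sum, hc a ha]

theorem mem_zeroCode {K : Type*} [Field K] [Algebra F K] {R : Set K} {c : Fin n → F} :
    c ∈ zeroCode n R ↔ ∀ a ∈ R, ∑ j : Fin n, algebraMap F K (c j) * a ^ (j : ℕ) = 0 :=
  Iff.rfl

theorem isConstacyclic_zeroCode {K : Type*} [Field K] [Algebra F K] {R : Set K} {lam : F}
    (hR : ∀ a ∈ R, a ^ n = algebraMap F K lam) : IsConstacyclic lam (zeroCode (F := F) n R) := by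
  intro c hc a ha
  obtain _ | m := n
  · simp
  have h := hc a ha
  rw [Fin.sum_univ_castSucc] at h
  rw [Fin.sum_univ_succ]
  have h1 : ∀ j : Fin m, constaShift lam c j.succ = c j.castSucc := by
    intro j
    simp only [constaShift, Fin.val_succ, Nat.add_sub_cancel, Nat.succ_ne_zero, if_false]
    rfl
  have h2 : constaShift lam c 0 = lam * c (Fin.last m) := by
    simp only [constaShift, Fin.val_zero, if_true]
    rfl
  simp only [h1, h2, Fin.val_zero, pow_zero, mul_one, Fin.val_succ, map_mul, ← hR a ha]
  have h3 := congrArg (fun z => a * z) h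
  simp only [mul_add, mul_zero, Finset.mul_sum, Fin.val_castSucc, Fin.val_last] at h3
  rw [← h3, add_comm]
  congr 1
  · exact Finset.sum_congr rfl fun j _ => by ring
  · ring

variable {K : Type*} [Field K] [Algebra F K]

theorem mem_zeroCode_iff_dvd {R : Finset K} {g : Polynomial F}
    (hg : g.map (algebraMap F K) = ∏ a ∈ R, (Polynomial.X - Polynomial.C a)) {c : Fin n → F} :
    c ∈ zeroCode n (R : Set K) ↔ g ∣ codePoly n c := by
  rw [← Polynomial.map_dvd_map' (algebraMap F K), hg, mem_zeroCode]
  constructor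
  · intro h
    apply Finset.prod_dvd_of_coprime
    · intro a _ b _ hab
      exact Polynomial.isCoprime_X_sub_C_of_isUnit_sub (sub_ne_zero.2 hab).isUnit
    · intro a ha
      rw [Polynomial.dvd_iff_isRoot, Polynomial.IsRoot.def, Polynomial.eval_map_algebraMap,
        aeval_codePoly]
      exact h a (Finset.mem_coe.2 ha)
  · intro h a ha
    rw [Finset.mem_coe] at ha
    rw [← aeval_codePoly, ← Polynomial.eval_map_algebraMap, ← Polynomial.IsRoot.def,
      ← Polynomial.dvd_iff_isRoot]
    exact (Finset.dvd_prod_of_mem (fun b : K => Polynomial.X - Polynomial.C b) ha).trans h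

theorem natDegree_eq_card_of_map_eq {R : Finset K} {g : Polynomial F}
    (hg : g.map (algebraMap F K) = ∏ a ∈ R, (Polynomial.X - Polynomial.C a)) :
    g.Monic ∧ g.natDegree = R.card := by
  constructor
  · refine Polynomial.monic_of_injective (algebraMap F K).injective ?_
    rw [hg]
    exact Polynomial.monic_prod_X_sub_C _ _
  · rw [← Polynomial.natDegree_map (algebraMap F K), hg, Polynomial.natDegree_finsetProd_X_sub_C_eq_card]

/-- Multiplication by the generator polynomial `g` identifies polynomials of degree below `n -
R.card` with the code. -/
theorem finrank_zeroCode {R : Finset K} {g : Polynomial F}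
    (hg : g.map (algebraMap F K) = ∏ a ∈ R, (Polynomial.X - Polynomial.C a)) (hR : R.card ≤ n) :
    Module.finrank F (zeroCode (F := F) n (R : Set K)) = n - R.card := by
  obtain ⟨hmon, hdeg⟩ := natDegree_eq_card_of_map_eq hg
  set m := n - R.card with hm
  let Φ : (Fin m → F) →ₗ[F] (Fin n → F) :=
    LinearMap.pi fun j => (Polynomial.lcoeff F (j : ℕ)).comp
      ((LinearMap.mulLeft F g).comp (codePoly m))
  have hΦ : ∀ a, codePoly n (Φ a) = g * codePoly m a := by
    intro a
    refine codePoly_coeff (P := g * codePoly m a) ?_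
    rw [Polynomial.degree_mul, Polynomial.degree_eq_natDegree hmon.ne_zero, hdeg]
    rcases eq_or_ne (codePoly m a) 0 with h0 | h0
    · rw [h0]; simp
    · have := degree_codePoly_lt a
      rw [Polynomial.degree_eq_natDegree h0] at this ⊢
      norm_cast at this ⊢
      omega
  have hinj : Function.Injective Φ := by
    intro a b hab
    apply codePoly_injective
    apply mul_left_cancel₀ hmon.ne_zero
    rw [← hΦ, ← hΦ, hab]
  have hrange : LinearMap.range Φ = zeroCode n (R : Set K) := by
    ext c
    rw [mem_zeroCode_iff_dvd hg]
    constructor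
    · rintro ⟨a, rfl⟩
      exact ⟨_, hΦ a⟩
    · rintro ⟨f, hf⟩
      have hfd : f.degree < m := by
        rcases eq_or_ne f 0 with h0 | h0
        · rw [h0, Polynomial.degree_zero]; exact WithBot.bot_lt_coe _
        · have := degree_codePoly_lt c
          rw [hf, Polynomial.degree_mul, Polynomial.degree_eq_natDegree hmon.ne_zero, hdeg,
            Polynomial.degree_eq_natDegree h0] at this
          rw [Polynomial.degree_eq_natDegree h0]
          norm_cast at this ⊢
          omega
      refine ⟨fun j => f.coeff j, ?_⟩
      apply codePoly_injective
      rw [hΦ, codePoly_coeff hfd, hf]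
  rw [← hrange, LinearMap.finrank_range_of_inj hinj, Module.finrank_fin_fun]

/-- The BCH bound: a nonzero word annihilated by `b * a ^ k` for `k < d`, with `a` of order at
least `n`, has weight more than `d`. -/
theorem lt_card_support_of_forall_eq_zero {a b : K} {d : ℕ} (hb : b ≠ 0)
    (ha : Function.Injective fun j : Fin n => a ^ (j : ℕ)) {c : Fin n → F}
    (hc : c ≠ 0)
    (h : ∀ k < d, ∑ j : Fin n, algebraMap F K (c j) * (b * a ^ k) ^ (j : ℕ) = 0)
    {s : Finset (Fin n)} (hs : ∀ j, c j ≠ 0 → j ∈ s) : d < s.card := by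
  classical
  by_contra! hsd
  obtain ⟨j₀, hj₀⟩ := Function.ne_iff.1 hc
  -- `P` vanishes at every locator `a ^ j` with `j ∈ s` except `j₀`. Its degree is below `d`, so
  -- combining the check equations with the coefficients of `P` isolates the term at `j₀`.
  set P : Polynomial K :=
    ∏ j ∈ s.erase j₀, (Polynomial.X - Polynomial.C (a ^ (j : ℕ))) with hP
  have hPdeg : P.natDegree < d := by
    rw [hP, Polynomial.natDegree_prod_of_monic _ _ fun j _ => Polynomial.monic_X_sub_C _]
    simp only [Polynomial.natDegree_X_sub_C, Finset.sum_const, smul_eq_mul, mul_one]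
    rw [Finset.card_erase_of_mem (hs _ hj₀)]
    have : 0 < s.card := Finset.card_pos.2 ⟨_, hs _ hj₀⟩
    omega
  have hsum : ∑ j : Fin n, algebraMap F K (c j) * b ^ (j : ℕ) * P.eval (a ^ (j : ℕ)) = 0 := by
    simp only [Polynomial.eval_eq_sum_range, Finset.mul_sum]
    rw [Finset.sum_comm]
    apply Finset.sum_eq_zero
    intro k hk
    rw [Finset.mem_range] at hk
    have := h k (by omega)
    rw [← mul_zero (P.coeff k), ← this, Finset.mul_sum]
    refine Finset.sum_congr rfl fun j _ => ?_
    rw [mul_pow, ← pow_mul, ← pow_mul, mul_comm k]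
    ring
  rw [Finset.sum_eq_single j₀] at hsum
  · have h1 : algebraMap F K (c j₀) ≠ 0 := by simpa using hj₀
    have h2 : P.eval (a ^ (j₀ : ℕ)) ≠ 0 := by
      rw [hP, Polynomial.eval_prod, Finset.prod_ne_zero_iff]
      intro j hj
      simp only [Polynomial.eval_sub, Polynomial.eval_X, Polynomial.eval_C]
      rw [sub_ne_zero]
      exact fun he => (Finset.ne_of_mem_erase hj) (ha he).symm
    exact mul_ne_zero (mul_ne_zero h1 (pow_ne_zero _ hb)) h2 hsum
  · intro j _ hj
    by_cases hcj : c j = 0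
    · simp [hcj]
    · have : P.eval (a ^ (j : ℕ)) = 0 := by
        rw [hP, Polynomial.eval_prod]
        exact Finset.prod_eq_zero (Finset.mem_erase.2 ⟨hj, hs _ hcj⟩) (by simp)
      rw [this, mul_zero]
  · simp

end

theorem injOn_pow_zSet {K : Type*} [Field K] {n r : ℕ} (hr : 0 < r) {β : K}
    (hβ : IsPrimitiveRoot β (n * r)) : Set.InjOn (fun i => β ^ i) (zSet n r : Set ℕ) := by
  intro i hi j hj hij
  have hi' := (mem_zSet_iff hr).1 hi
  have hj' := (mem_zSet_iff hr).1 hj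
  have hβ0 : β ≠ 0 := hβ.ne_zero (by omega)
  wlog hle : i ≤ j generalizing i j
  · exact (this hj hi hij.symm hj' hi' (by omega)).symm
  have h1 : β ^ (j - i) = 1 := by
    apply mul_left_cancel₀ (pow_ne_zero i hβ0)
    simp only at hij
    rw [← pow_add, mul_one, Nat.add_sub_cancel' hle, hij]
  have h2 := (hβ.pow_eq_one_iff_dvd _).1 h1
  by_contra hne
  have := Nat.le_of_dvd (by omega) h2
  omega

/-- The last clause puts the distance bound in the form used later: it depends only on the first
index `k` missing from `T`. The alternative `T = zSet n r` gives the zero code. -/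
theorem exists_constacyclic_code {F : Type*} [Field F] [Fintype F] [DecidableEq F] {K : Type*}
    [Field K] [Algebra F K] {n r : ℕ} (hr : 0 < r) (hn : 0 < n) {lam : F} {β : K}
    (hβ : IsPrimitiveRoot β (n * r)) (hlam : β ^ n = algebraMap F K lam) (hlr : lam ^ r = 1)
    {T : Finset ℕ} (hTZ : T ⊆ zSet n r)
    (hT : ∀ x ∈ T, cycCoset (Fintype.card F) (n * r) x ⊆ T) :
    ∃ C : Submodule F (Fin n → F), IsConstacyclic lam C ∧ definingSet r β C = ↑T ∧
      Module.finrank F C = n - T.card ∧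
      (T = zSet n r ∨ ∃ k < n, 1 + k * r ∉ T ∧ (∀ m < k, 1 + m * r ∈ T) ∧
        ∀ x ∈ C, ∀ y ∈ C, x ≠ y → k + 1 ≤ hammingDist x y) := by
  classical
  have hβ0 : β ≠ 0 := hβ.ne_zero (Nat.mul_pos hn hr).ne'
  have hinj := injOn_pow_zSet hr hβ
  set R : Finset K := T.image fun i => β ^ i with hRdef
  have hRcard : R.card = T.card := Finset.card_image_of_injOn (hinj.mono hTZ)
  have hTn : T.card ≤ n := (Finset.card_le_card hTZ).trans (card_zSet hr).le
  have hRfrob : ∀ a ∈ R, a ^ Fintype.card F ∈ R := by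
    intro a ha
    obtain ⟨i, hi, rfl⟩ := Finset.mem_image.1 ha
    have hM : 0 < n * r := Nat.mul_pos hn hr
    have hi' := (mem_zSet_iff hr).1 (hTZ hi)
    have hiq : 1 ≤ i * Fintype.card F := Nat.mul_pos hi'.1 Fintype.card_pos
    -- The shift by one picks the representative in `1, …, n * r` rather than `0, …, n * r - 1`.
    set y := (i * Fintype.card F - 1) % (n * r) + 1 with hy
    have hmod : y ≡ i * Fintype.card F [MOD n * r] := by
      have : (i * Fintype.card F - 1) % (n * r) + 1 ≡ (i * Fintype.card F - 1) + 1 [MOD n * r] :=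
        (Nat.mod_modEq _ _).add_right 1
      rwa [Nat.sub_add_cancel hiq] at this
    have hyT : y ∈ T := by
      apply hT i hi
      refine mem_cycCoset.2 ⟨⟨by omega, ?_⟩, 1, by simpa using hmod⟩
      have := Nat.mod_lt (i * Fintype.card F - 1) hM
      omega
    refine Finset.mem_image.2 ⟨y, hyT, ?_⟩
    rw [← pow_mul]
    exact hβ.pow_eq_pow_of_modEq hmod
  obtain ⟨g, hg⟩ := exists_map_eq_prod_X_sub_C (F := F) R hRfrob
  obtain ⟨hmon, hdeg⟩ := natDegree_eq_card_of_map_eq hg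
  have hdefsub : ∀ i ∈ T, i ∈ definingSet r β (zeroCode (F := F) n (R : Set K)) :=
    fun i hi => ⟨hTZ hi, fun c hc => hc _ (Finset.mem_coe.2 (Finset.mem_image_of_mem _ hi))⟩
  refine ⟨zeroCode n (R : Set K), isConstacyclic_zeroCode ?_, ?_, ?_, ?_⟩
  · intro a ha
    obtain ⟨i, hi, rfl⟩ := Finset.mem_image.1 (Finset.mem_coe.1 ha)
    have hi' := (mem_zSet_iff hr).1 (hTZ hi)
    have h1 : r ∣ i - 1 := (Nat.modEq_iff_dvd' hi'.1).1 hi'.2.2.symm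
    obtain ⟨k, hk⟩ := h1
    have hik : i = r * k + 1 := by omega
    rw [← pow_mul, mul_comm, pow_mul, hlam, ← map_pow, hik, pow_succ, pow_mul, hlr, one_pow,
      one_mul]
  · apply Set.Subset.antisymm
    · intro i hi
      by_contra hiT
      have hiT' : i ∉ T := hiT
      have hlt : T.card < n := by
        rw [← card_zSet hr (n := n)]
        exact Finset.card_lt_card (Finset.ssubset_iff_of_subset hTZ |>.2 ⟨i, hi.1, hiT'⟩)
      have hgd : g.degree < n := by
        rw [Polynomial.degree_eq_natDegree hmon.ne_zero, hdeg, hRcard]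
        exact_mod_cast hlt
      -- When `T` is not all of `Z_{n,r}`, `g` has degree below `n` and is itself a codeword; its
      -- only roots are the `β ^ j` with `j ∈ T`.
      have h1 := hi.2 (fun j => g.coeff j)
        ((mem_zeroCode_iff_dvd hg).2 (by rw [codePoly_coeff hgd]))
      rw [← aeval_codePoly, codePoly_coeff hgd, ← Polynomial.eval_map_algebraMap, hg,
        Polynomial.eval_prod, Finset.prod_eq_zero_iff] at h1
      obtain ⟨a, ha, ha0⟩ := h1
      obtain ⟨j, hj, rfl⟩ := Finset.mem_image.1 ha
      simp only [Polynomial.eval_sub, Polynomial.eval_X, Polynomial.eval_C] at ha0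
      have := hinj (Finset.mem_coe.2 hi.1) (Finset.mem_coe.2 (hTZ hj)) (sub_eq_zero.1 ha0)
      exact hiT' (this ▸ hj)
    · exact fun i hi => hdefsub i hi
  · rw [finrank_zeroCode hg (hRcard.trans_le hTn), hRcard]
  · by_cases hex : ∃ k, k < n ∧ 1 + k * r ∉ T
    · right
      have hk := Nat.find_spec hex
      have hmin : ∀ m < Nat.find hex, 1 + m * r ∈ T := by
        intro m hm
        have := Nat.find_min hex hm
        by_contra hmT
        exact this ⟨by omega, hmT⟩
      refine ⟨Nat.find hex, hk.1, hk.2, hmin, ?_⟩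
      intro x hx y hy hxy
      have hsub := Submodule.sub_mem _ hx hy
      have := lt_card_support_of_forall_eq_zero (c := x - y) (b := β) (a := β ^ r)
        (d := Nat.find hex) (s := Finset.univ.filter fun j => x j ≠ y j) hβ0 ?_
        (sub_ne_zero.2 hxy) ?_ ?_
      · exact this
      · have hprim : IsPrimitiveRoot (β ^ r) n := hβ.pow (Nat.mul_pos hn hr) (mul_comm _ _)
        intro i j hij
        exact Fin.ext (hprim.pow_inj i.2 j.2 hij)
      · intro k hk
        rw [← pow_mul, ← pow_succ', mul_comm, add_comm]
        exact (hdefsub _ (hmin k hk)).2 _ hsub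
      · intro j hj
        simpa [sub_ne_zero] using hj
    · left
      push Not at hex
      apply hTZ.antisymm
      intro x hx
      obtain ⟨k, hk, rfl⟩ := Finset.mem_image.1 hx
      exact hex k (Finset.mem_range.1 hk)

theorem exists_isPrimitiveRoot_pow_eq {K : Type*} [Field K] [IsAlgClosed K] {n r : ℕ}
    (hnr : ((n * r : ℕ) : K) ≠ 0) {l : K} (hl : IsPrimitiveRoot l r) :
    ∃ β : K, IsPrimitiveRoot β (n * r) ∧ β ^ n = l := by
  have hnr0 : n * r ≠ 0 := by rintro h; rw [h] at hnr; simp at hnr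
  have : NeZero (n * r) := ⟨hnr0⟩
  have : NeZero r := ⟨right_ne_zero_of_mul hnr0⟩
  have : NeZero ((n * r : ℕ) : K) := ⟨hnr⟩
  obtain ⟨β₀, hβ₀⟩ := HasEnoughRootsOfUnity.exists_primitiveRoot K (n * r)
  have hprim : IsPrimitiveRoot (β₀ ^ n) r := hβ₀.pow (Nat.pos_of_ne_zero hnr0) rfl
  obtain ⟨a, -, hac, ha⟩ := (hprim.isPrimitiveRoot_iff).1 hl
  -- `l` is a power of `β₀ ^ n` with exponent `a` prime to `r`. Lifting `a` to a unit modulo `n * r`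
  -- keeps `β₀ ^ u` primitive.
  obtain ⟨u, hu⟩ := ZMod.unitsMap_surjective (dvd_mul_left r n) (ZMod.unitOfCoprime a hac)
  have hmod : (u : ZMod (n * r)).val ≡ a [MOD r] := by
    rw [← ZMod.natCast_eq_natCast_iff, ← ZMod.coe_unitOfCoprime a hac, ← hu, ZMod.unitsMap_val]
    rw [ZMod.natCast_val]
  refine ⟨β₀ ^ (u : ZMod (n * r)).val, hβ₀.pow_of_coprime _ (ZMod.val_coe_unit_coprime u), ?_⟩
  rw [← pow_mul, mul_comm, pow_mul, ← ha]
  exact hprim.pow_eq_pow_of_modEq hmod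

/-! ### Counting multiples of `q`, leaders and fixed points -/

theorem modEq_one_of_dvd_sub_one {q r : ℕ} (hq : 0 < q) (hr : r ∣ q - 1) : q ≡ 1 [MOD r] :=
  ((Nat.modEq_iff_dvd' hq).2 hr).symm

theorem div_le_card_filter_dvd {q r : ℕ} (hq : 0 < q) (hr : r ∣ q - 1) (K : ℕ) :
    K / q ≤ ((Finset.range K).filter fun k => q ∣ 1 + k * r).card := by
  obtain ⟨c, hc⟩ := hr
  have hr0 : 0 < r ∨ q = 1 := by
    rcases Nat.eq_zero_or_pos r with h | h
    · right; rw [h, zero_mul] at hc; omega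
    · exact Or.inl h
  rcases hr0 with hr0 | rfl
  · have hcq : c < q := by
      have : c ≤ r * c := Nat.le_mul_of_pos_left _ hr0
      omega
    rw [← Finset.card_range (K / q)]
    -- With `q = 1 + r * c`, the index `k = c + q * m` gives `1 + k * r = q * (1 + m * r)`.
    apply Finset.card_le_card_of_injOn (fun m => c + q * m)
    · intro m hm
      have hm' : m < K / q := by simpa using hm
      have h1 : q * (m + 1) ≤ q * (K / q) := Nat.mul_le_mul_left _ hm'
      have h2 := Nat.mul_div_le K q
      simp only [Finset.coe_filter, Finset.mem_range, Set.mem_ofPred_eq]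
      refine ⟨by rw [mul_add] at h1; omega, 1 + m * r, ?_⟩
      have h3 : r * c + 1 = q := by omega
      calc 1 + (c + q * m) * r = (r * c + 1) + q * m * r := by ring
        _ = q * (1 + m * r) := by rw [h3]; ring
    · intro a _ b _ hab
      have : q * a = q * b := by simpa using hab
      exact Nat.eq_of_mul_eq_mul_left hq this
  · simp

theorem card_add_div_le {q r K : ℕ} (hq : 0 < q) (hr : r ∣ q - 1) {X : Finset ℕ}
    (hX : ∀ x ∈ X, ¬ q ∣ x ∧ ∃ k < K, x = 1 + k * r) : X.card + K / q ≤ K := by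
  have h1 : X.card ≤ ((Finset.range K).filter fun k => ¬ q ∣ 1 + k * r).card := by
    apply (Finset.card_le_card (t := ((Finset.range K).filter fun k => ¬ q ∣ 1 + k * r).image
      fun k => 1 + k * r) ?_).trans Finset.card_image_le
    intro x hx
    obtain ⟨hqx, k, hk, rfl⟩ := hX x hx
    exact Finset.mem_image.2 ⟨k, by simp [hk, hqx], rfl⟩
  have h2 := div_le_card_filter_dvd hq hr K
  have h3 := Finset.card_filter_add_card_filter_not (s := Finset.range K) (fun k => q ∣ 1 + k * r)
  rw [Finset.card_range] at h3
  omega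

theorem not_dvd_of_mem_cosetLeaders {q n r p l x : ℕ} (hr : 0 < r) (hp : 0 < p) (hq : 2 ≤ q)
    (hM : n * r ∣ q ^ p - 1) (hx : x ∈ cosetLeaders q n r l) : ¬ q ∣ x := by
  rintro ⟨y, rfl⟩
  rw [mem_cosetLeaders] at hx
  have hx' := (mem_zSet_iff hr).1 hx.1
  have hy : 1 ≤ y := by
    rcases Nat.eq_zero_or_pos y with h | h
    · rw [h, mul_zero] at hx'; omega
    · exact h
  have hyq : 2 * y ≤ q * y := Nat.mul_le_mul_right _ hq
  have hmem : y ∈ cycCoset q (n * r) (q * y) := by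
    refine mem_cycCoset.2 ⟨⟨hy, by omega⟩, p - 1, ?_⟩
    have h1 : q * y * q ^ (p - 1) = y * q ^ p := by
      obtain ⟨p, rfl⟩ : ∃ p', p = p' + 1 := ⟨p - 1, by omega⟩
      simp only [Nat.add_sub_cancel]; ring
    rw [h1]
    simpa using ((pow_modEq_one_of_dvd (by omega) hM).mul_left y).symm
  have := hx.2.2 y hmem
  omega

theorem mem_cosetLeaders_one {q n r p x : ℕ} (hr : 0 < r) (hp : p.Prime) (hq : 2 ≤ q) (hn : 0 < n)
    (hM : n * r ∣ q ^ p - 1) : x ∈ cosetLeaders q n r 1 ↔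
      x ∈ zSet n r ∧ n * r / Nat.gcd (n * r) (q - 1) ∣ x := by
  have hM0 : 0 < n * r := Nat.mul_pos hn hr
  have hg : 0 < Nat.gcd (n * r) (q - 1) := Nat.gcd_pos_of_pos_left _ hM0
  have hdvd : n * r ∣ x * (q - 1) ↔ n * r / Nat.gcd (n * r) (q - 1) ∣ x := by
    have hcop := Nat.coprime_div_gcd_div_gcd hg
    obtain ⟨a, ha⟩ := Nat.gcd_dvd_left (n * r) (q - 1)
    obtain ⟨b, hb⟩ := Nat.gcd_dvd_right (n * r) (q - 1)
    set g := Nat.gcd (n * r) (q - 1)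
    have ha' : n * r / g = a := by rw [ha]; exact Nat.mul_div_cancel_left _ hg
    have hb' : (q - 1) / g = b := by rw [hb]; exact Nat.mul_div_cancel_left _ hg
    rw [ha', hb'] at hcop
    rw [ha', ha, hb, mul_left_comm, Nat.mul_dvd_mul_iff_left hg]
    exact hcop.dvd_mul_right
  rw [mem_cosetLeaders, ← hdvd]
  rcases card_cycCoset (i := x) hp (by omega) hM0 hM with ⟨h1, h2⟩ | ⟨h1, h2⟩
  · refine ⟨fun h => ⟨h.1, h2⟩, fun h => ⟨h.1, h1, ?_⟩⟩
    intro y hy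
    have hx' := (mem_zSet_iff hr).1 h.1
    have hxm := self_mem_cycCoset (q := q) hx'.1 hx'.2.1
    exact (Finset.card_le_one.1 h1.le x hxm y hy).le
  · refine ⟨fun h => ?_, fun h => absurd h.2 h2⟩
    exact absurd (h1.symm.trans h.2.1) hp.one_lt.ne'

theorem div_gcd_mul_gcd {q n r : ℕ} (hr0 : 0 < r) (hr : r ∣ q - 1) :
    n * r / Nat.gcd (n * r) (q - 1) * Nat.gcd n ((q - 1) / r) = n := by
  obtain ⟨c, hc⟩ := hr
  rw [hc, Nat.mul_div_cancel_left _ hr0, mul_comm n r, Nat.gcd_mul_left,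
    Nat.mul_div_mul_left _ _ hr0]
  exact Nat.div_mul_cancel (Nat.gcd_dvd_left _ _)

/-- By the Chinese remainder theorem, `m ∣ x` and `x ≡ 1` modulo `r` define one class modulo `m *
r`. The interval `(0, n * r]` consists of exactly `gcd (n, (q - 1) / r)` full periods. -/
theorem card_cosetLeaders_one {q n r p : ℕ} (hr0 : 0 < r) (hr : r ∣ q - 1) (hp : p.Prime)
    (hq : 2 ≤ q) (hn : 0 < n) (hM : n * r ∣ q ^ p - 1)
    (hco : Nat.gcd r (n * r / Nat.gcd (n * r) (q - 1)) = 1) :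
    (cosetLeaders q n r 1).card = Nat.gcd n ((q - 1) / r) := by
  have hprod := div_gcd_mul_gcd hr0 hr (n := n)
  set m := n * r / Nat.gcd (n * r) (q - 1) with hm
  set N := Nat.gcd n ((q - 1) / r)
  have hm0 : 0 < m := by
    rcases Nat.eq_zero_or_pos m with h | h
    · rw [h, zero_mul] at hprod; omega
    · exact h
  have hco' : Nat.Coprime m r := Nat.Coprime.symm hco
  obtain ⟨v, hv1, hv2⟩ := Nat.chineseRemainder hco' 0 1
  have hset : cosetLeaders q n r 1 =
      (Finset.Ioc 0 (n * r)).filter fun x => x ≡ v [MOD m * r] := by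
    ext x
    rw [mem_cosetLeaders_one hr0 hp hq hn hM, mem_zSet_iff hr0, Finset.mem_filter, Finset.mem_Ioc,
      ← Nat.modEq_and_modEq_iff_modEq_mul hco', ← hm, ← Nat.modEq_zero_iff_dvd]
    constructor
    · rintro ⟨⟨h1, h2, h3⟩, h4⟩
      exact ⟨⟨h1, h2⟩, h4.trans hv1.symm, h3.trans hv2.symm⟩
    · rintro ⟨⟨h1, h2⟩, h3, h4⟩
      exact ⟨⟨h1, h2, h4.trans hv2⟩, h3.trans hv1⟩
  have hpos : 0 < m * r := Nat.mul_pos hm0 hr0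
  have hcount := Nat.Ioc_filter_modEq_card 0 (n * r) hpos v
  rw [← hset] at hcount
  have hq0 : ((m * r : ℕ) : ℚ) ≠ 0 := by exact_mod_cast hpos.ne'
  have h1 : (((n * r : ℕ) : ℚ) - v) / ((m * r : ℕ) : ℚ) =
      ((0 : ℕ) - (v : ℚ)) / ((m * r : ℕ) : ℚ) + (N : ℕ) := by
    have : ((n * r : ℕ) : ℚ) = N * ((m * r : ℕ) : ℚ) := by
      rw [← hprod]; push_cast; ring
    rw [this]
    field_simp
    push_cast
    ring
  rw [h1, Int.floor_add_natCast] at hcount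
  have h2 : ((cosetLeaders q n r 1).card : ℤ) = N := by
    rw [hcount, add_sub_cancel_left]
    exact max_eq_left (by positivity)
  exact_mod_cast h2

/-- Leaders of size 1 are congruent modulo `m * r`, so each smaller one accounts for a gap of at
least `m * r` below `x`. -/
theorem rank_mul_le {q n r p A x : ℕ} (hr0 : 0 < r) (hp : p.Prime)
    (hq : 2 ≤ q) (hn : 0 < n) (hM : n * r ∣ q ^ p - 1)
    (hco : Nat.gcd r (n * r / Nat.gcd (n * r) (q - 1)) = 1) (hx : x ∈ cosetLeaders q n r 1)
    (hA : A ≤ ((cosetLeaders q n r 1).filter fun j => j < x).card) :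
    A * (n * r / Nat.gcd (n * r) (q - 1) * r) ≤ x - 1 := by
  set m := n * r / Nat.gcd (n * r) (q - 1) with hm
  have hM0 : 0 < n * r := Nat.mul_pos hn hr0
  have hm0 : 0 < m := Nat.div_pos (Nat.le_of_dvd hM0 (Nat.gcd_dvd_left _ _))
    (Nat.gcd_pos_of_pos_left _ hM0)
  have hpos : 0 < m * r := Nat.mul_pos hm0 hr0
  have hdvd : ∀ j ∈ (cosetLeaders q n r 1).filter (fun j => j < x),
      1 ≤ j ∧ j < x ∧ m * r ∣ x - j := by
    intro j hj
    obtain ⟨hj1, hjx⟩ := Finset.mem_filter.1 hj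
    have hj2 := (mem_cosetLeaders_one hr0 hp hq hn hM).1 hj1
    have hx2 := (mem_cosetLeaders_one hr0 hp hq hn hM).1 hx
    have hj3 := (mem_zSet_iff hr0).1 hj2.1
    have hx3 := (mem_zSet_iff hr0).1 hx2.1
    refine ⟨hj3.1, hjx, ?_⟩
    apply Nat.Coprime.mul_dvd_of_dvd_of_dvd (Nat.Coprime.symm hco)
    · exact Nat.dvd_sub hx2.2 hj2.2
    · exact (Nat.modEq_iff_dvd' hjx.le).1 (hj3.2.2.trans hx3.2.2.symm)
  have hcard : ((cosetLeaders q n r 1).filter fun j => j < x).card ≤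
      (Finset.Icc 1 ((x - 1) / (m * r))).card := by
    apply Finset.card_le_card_of_injOn (fun j => (x - j) / (m * r))
    · intro j hj
      obtain ⟨h1, h2, h3⟩ := hdvd j hj
      simp only [Finset.coe_Icc, Set.mem_Icc]
      refine ⟨?_, Nat.div_le_div_right (by omega)⟩
      exact Nat.div_pos (Nat.le_of_dvd (by omega) h3) hpos
    · intro j hj k hk hjk
      obtain ⟨h1, h2, h3⟩ := hdvd j hj
      obtain ⟨h4, h5, h6⟩ := hdvd k hk
      have h7 := Nat.div_mul_cancel h3
      have h8 := Nat.div_mul_cancel h6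
      simp only at hjk
      rw [hjk] at h7
      omega
  rw [Nat.card_Icc, Nat.add_sub_cancel] at hcard
  calc A * (m * r) ≤ (x - 1) / (m * r) * (m * r) := Nat.mul_le_mul_right _ (hA.trans hcard)
    _ ≤ x - 1 := Nat.div_mul_le_self _ _

/-! ### The non-leaders encoded by `S_p` -/

/-- Clearing the denominator in the bound on `t` yields the integer inequality, and `s > 0` makes
the logarithm positive, whence `i < p`. -/
theorem sSet_bounds {q p s r h i j t : ℕ} (hq : 2 ≤ q) (hs : 0 < s)
    (hS : (i, j, t) ∈ sSet q p s r h) :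
    p < 2 * i ∧ i < p ∧ 1 ≤ j ∧ j < q ∧ (q * t + j) * (q ^ (p - i) - 1) + 1 < q ^ i ∧
      q ^ i + q * t + j ≡ 1 [MOD r] ∧
      ((q ^ i + q * t + j : ℕ) : ℤ) ≤ 1 + (⌈(q : ℚ) * h / ((q : ℚ) - 1)⌉ - 2) * r := by
  obtain ⟨h1, h2, h3, h4, h5, h6, h7⟩ := hS
  have hqR : (1 : ℝ) < q := by exact_mod_cast hq
  have hlog : 0 < Real.logb q ((s : ℝ) + 1) := by
    apply Real.logb_pos hqR
    have : (0 : ℝ) < s := by exact_mod_cast hs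
    linarith
  have hip : i < p := by
    have h8 := Int.le_floor.1 h2
    push_cast at h8
    have : (i : ℝ) < p := by linarith
    exact_mod_cast this
  have hi : p < 2 * i := by
    have : (p : ℝ) < 2 * i := by linarith
    exact_mod_cast this
  refine ⟨hi, hip, h3, by omega, ?_, h6, h7⟩
  have hE : 1 ≤ q ^ (p - i) := Nat.one_le_pow _ _ (by omega)
  have hE2 : (1 : ℝ) < (q : ℝ) ^ (p - i) := one_lt_pow₀ hqR (by omega)
  have hB : (0 : ℝ) < (q : ℝ) ^ (p - i + 1) - q := by
    rw [pow_succ]; nlinarith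
  rw [lt_div_iff₀ hB, pow_succ] at h5
  have : (((q * t + j) * (q ^ (p - i) - 1) + 1 : ℕ) : ℝ) < ((q ^ i : ℕ) : ℝ) := by
    push_cast [Nat.cast_sub hE]
    linarith
  exact_mod_cast this

/-- The triple `(i, j, t)` encodes `q ^ i + q * t + j`. Here `q ^ i` dominates `q * t + j`, and `j`
is the last base-`q` digit, so the encoding is injective. -/
theorem exists_finset_card_eq_ncard_sSet {q n r p s h : ℕ} (hr0 : 0 < r) (hq : 2 ≤ q)
    (hM : n * r * s = q ^ p - 1) (hs : 0 < s) :
    ∃ X : Finset ℕ, X.card = (sSet q p s r h).ncard ∧ ∀ x ∈ X, ¬ q ∣ x ∧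
      (∃ k : ℕ, 1 ≤ k ∧ x = 1 + k * r ∧ (k : ℤ) + 2 ≤ ⌈(q : ℚ) * h / ((q : ℚ) - 1)⌉) ∧
      ∀ l, x ∉ cosetLeaders q n r l := by
  classical
  set D := ⌈(q : ℚ) * h / ((q : ℚ) - 1)⌉ with hD
  have hMd : n * r ∣ q ^ p - 1 := ⟨s, hM.symm⟩
  set val : ℕ × ℕ × ℕ → ℕ := fun x => q ^ x.1 + q * x.2.2 + x.2.1 with hval
  have hlt : ∀ i j t, (i, j, t) ∈ sSet q p s r h → q * t + j + 1 < q ^ i := by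
    intro i j t hS
    obtain ⟨h1, h2, h3, h4, h5, -, -⟩ := sSet_bounds hq hs hS
    have hE : q ≤ q ^ (p - i) := Nat.le_self_pow (by omega) q
    have : (q * t + j) * 1 ≤ (q * t + j) * (q ^ (p - i) - 1) :=
      Nat.mul_le_mul_left _ (by omega)
    omega
  have hinj : Set.InjOn val (sSet q p s r h) := by
    have key : ∀ i j t i' j' t', (i, j, t) ∈ sSet q p s r h → (i', j', t') ∈ sSet q p s r h →
        i < i' → val (i, j, t) < val (i', j', t') := by
      intro i j t i' j' t' hS hS' hii
      have h1 := hlt i j t hS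
      have h2 : q ^ (i + 1) ≤ q ^ i' := Nat.pow_le_pow_right (by omega) hii
      have h3 : 2 * q ^ i ≤ q ^ (i + 1) := by
        rw [pow_succ, mul_comm]; exact Nat.mul_le_mul_left _ hq
      simp only [hval]
      omega
    rintro ⟨i, j, t⟩ hS ⟨i', j', t'⟩ hS' he
    rcases lt_trichotomy i i' with hii | hii | hii
    · exact absurd he (key _ _ _ _ _ _ hS hS' hii).ne
    · subst hii
      obtain ⟨-, -, -, hj, -⟩ := sSet_bounds hq hs hS
      obtain ⟨-, -, -, hj', -⟩ := sSet_bounds hq hs hS'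
      have h1 : q * t + j = q * t' + j' := by simp only [hval] at he; omega
      have h2 : j = j' := by
        have := congrArg (· % q) h1
        simpa [Nat.mul_add_mod, Nat.mod_eq_of_lt hj, Nat.mod_eq_of_lt hj'] using this
      subst h2
      have h3 : t = t' := Nat.eq_of_mul_eq_mul_left (by omega) (by omega : q * t = q * t')
      rw [h3]
    · exact absurd he (key _ _ _ _ _ _ hS' hS hii).ne'
  -- The cutoff in `S_p` gives finiteness, so `ncard` is a true count and not its default value 0.
  have hfin : (val '' sSet q p s r h).Finite := by
    apply (Set.finite_Iic (1 + (D - 2) * r).toNat).subset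
    rintro _ ⟨⟨i, j, t⟩, hS, rfl⟩
    obtain ⟨-, -, -, -, -, -, h7⟩ := sSet_bounds hq hs hS
    simp only [hval, Set.mem_Iic]
    rw [← hD] at h7
    omega
  refine ⟨hfin.toFinset, ?_, ?_⟩
  · rw [← Set.ncard_eq_toFinset_card _ hfin, hinj.ncard_image]
  · intro x hx
    obtain ⟨⟨i, j, t⟩, hS, rfl⟩ := hfin.mem_toFinset.1 hx
    obtain ⟨h1, h2, h3, h4, h5, h6, h7⟩ := sSet_bounds hq hs hS
    have hqi : q ∣ q ^ i := dvd_pow_self q (by omega)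
    have hqi1 : 1 ≤ q ^ i := Nat.one_le_pow _ _ (by omega)
    simp only [hval]
    refine ⟨?_, ?_, ?_⟩
    · intro hdvd
      have h8 : q ∣ j := (Nat.dvd_add_right (hqi.add (dvd_mul_right q t))).1 hdvd
      exact absurd (Nat.le_of_dvd (by omega) h8) (by omega)
    · have h8 := (Nat.modEq_iff_dvd' (by omega : 1 ≤ q ^ i + q * t + j)).1 h6.symm
      obtain ⟨k, hk⟩ := h8
      have hk' : q ^ i + q * t + j = 1 + k * r := by rw [mul_comm k]; omega
      refine ⟨k, ?_, hk', ?_⟩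
      · by_contra h0
        have : k = 0 := by omega
        rw [this] at hk'
        omega
      · rw [hk'] at h7
        push_cast at h7
        have hr0' : (0 : ℤ) < r := by exact_mod_cast hr0
        have h9 : (k : ℤ) * r ≤ (D - 2) * r := by linarith
        have := le_of_mul_le_mul_right h9 hr0'
        linarith
    · intro l hl
      rw [mem_cosetLeaders] at hl
      have hx' := (mem_zSet_iff hr0).1 hl.1
      have hE : 1 ≤ q ^ (p - i) := Nat.one_le_pow _ _ (by omega)
      obtain ⟨E, hE'⟩ : ∃ E, q ^ (p - i) = E + 1 := ⟨q ^ (p - i) - 1, by omega⟩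
      have hlt' : 1 + q ^ (p - i) * (q * t + j) < q ^ i + q * t + j := by
        rw [hE', Nat.add_sub_cancel] at h5
        rw [hE']
        nlinarith
      -- Multiplying by `q ^ (p - i)` turns `q ^ i` into `q ^ p ≡ 1`. The bound on `t` makes the
      -- result smaller than the original, which is therefore no leader.
      have hmem : 1 + q ^ (p - i) * (q * t + j) ∈ cycCoset q (n * r) (q ^ i + q * t + j) := by
        refine mem_cycCoset.2 ⟨⟨by omega, by omega⟩, p - i, ?_⟩
        have h8 : (q ^ i + q * t + j) * q ^ (p - i) = q ^ p + q ^ (p - i) * (q * t + j) := by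
          have : q ^ i * q ^ (p - i) = q ^ p := by rw [← pow_add]; congr 1; omega
          rw [← this]; ring
        rw [h8]
        exact ((pow_modEq_one_of_dvd (by omega) hMd).add_right _).symm
      have := hl.2.2 _ hmem
      omega

theorem sSet_two {q s r h : ℕ} (hq : 2 ≤ q) (hs : 0 < s) : sSet q 2 s r h = ∅ := by
  ext ⟨i, j, t⟩
  simp only [Set.mem_empty_iff_false, iff_false]
  intro hS
  obtain ⟨h1, h2, -⟩ := sSet_bounds hq hs hS
  omega

/-! ### Lower bounds for the first missing residue -/

theorem exists_eq_of_mem_zSet_lt {n r k j : ℕ} (hj : j ∈ zSet n r)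
    (h : j < 1 + k * r) : ∃ m < k, j = 1 + m * r := by
  obtain ⟨m, -, rfl⟩ := Finset.mem_image.1 hj
  refine ⟨m, ?_, rfl⟩
  by_contra hm
  have := Nat.mul_le_mul_right r (not_lt.1 hm)
  omega

/-- A strictly smaller leader of its coset would already be covered, and with it the whole coset,
including `1 + k * r`. -/
theorem mem_cosetLeaders_of_first_missing {q n r p a b k : ℕ} (hr0 : 0 < r) (hr : r ∣ q - 1)
    (hp : p.Prime) (hq : 2 ≤ q) (hk : k < n) (hM : n * r ∣ q ^ p - 1)
    (hkT : 1 + k * r ∉ firstCosets q n r 1 a ∪ firstCosets q n r p b)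
    (hmin : ∀ m < k, 1 + m * r ∈ firstCosets q n r 1 a ∪ firstCosets q n r p b) :
    (1 + k * r ∈ cosetLeaders q n r 1 ∧
      a ≤ ((cosetLeaders q n r 1).filter fun j => j < 1 + k * r).card) ∨
    (1 + k * r ∈ cosetLeaders q n r p ∧
      b ≤ ((cosetLeaders q n r p).filter fun j => j < 1 + k * r).card) := by
  have hqr := modEq_one_of_dvd_sub_one (by omega : 0 < q) hr
  have hq0 : 0 < q := by omega
  have hxZ : 1 + k * r ∈ zSet n r := Finset.mem_image.2 ⟨k, Finset.mem_range.2 hk, rfl⟩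
  have hx' := (mem_zSet_iff hr0).1 hxZ
  have hxs := self_mem_cycCoset (q := q) hx'.1 hx'.2.1
  obtain ⟨y, hy, hyx, he⟩ := exists_cosetLeader hr0 hqr hp.pos hq0 hM hxZ
  have hyle : y ≤ 1 + k * r := (mem_cosetLeaders.1 hy).2.2 _ (he ▸ hxs)
  have hyeq : y = 1 + k * r := by
    by_contra hne
    obtain ⟨m, hm, rfl⟩ :=
      exists_eq_of_mem_zSet_lt (mem_cosetLeaders.1 hy).1 (lt_of_le_of_ne hyle hne)
    apply hkT
    rcases Finset.mem_union.1 (hmin m hm) with h | h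
    · exact Finset.mem_union_left _ (cycCoset_subset_firstCosets hp.pos hq0 hM h (he ▸ hxs))
    · exact Finset.mem_union_right _ (cycCoset_subset_firstCosets hp.pos hq0 hM h (he ▸ hxs))
  subst hyeq
  rw [Finset.mem_union, not_or] at hkT
  rcases card_cycCoset (i := 1 + k * r) hp hq0 (by omega) hM with ⟨h, -⟩ | ⟨h, -⟩
  · rw [h] at hy
    exact Or.inl ⟨hy, le_card_of_not_mem_firstCosets hr0 hy hkT.1⟩
  · rw [h] at hy
    exact Or.inr ⟨hy, le_card_of_not_mem_firstCosets hr0 hy hkT.2⟩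

theorem ceil_div_two (N : ℕ) : ⌈(N : ℚ) / 2⌉ = (((N + 1) / 2 : ℕ) : ℤ) := by
  rw [Int.ceil_eq_iff]
  have h1 : 2 * ((N + 1) / 2) ≤ N + 1 := Nat.mul_div_le _ _
  have h2 : N ≤ 2 * ((N + 1) / 2) := by omega
  have h1' : 2 * (((N + 1) / 2 : ℕ) : ℚ) ≤ N + 1 := by exact_mod_cast h1
  have h2' : (N : ℚ) ≤ 2 * (((N + 1) / 2 : ℕ) : ℚ) := by exact_mod_cast h2
  rw [Int.cast_natCast]
  constructor <;> linarith

theorem natCeil_div_two (N : ℕ) : ⌈(N : ℚ) / 2⌉₊ = (N + 1) / 2 := by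
  have h : (⌈(N : ℚ) / 2⌉₊ : ℤ) = _ := (Int.natCast_ceil_eq_ceil (by positivity)).trans
    (ceil_div_two N)
  exact_mod_cast h

theorem natFloor_div_two (N : ℕ) : ⌊(N : ℚ) / 2⌋₊ = N / 2 := by
  exact_mod_cast Nat.floor_div_eq_div (K := ℚ) N 2

theorem floor_div_two (N : ℕ) : ⌊(N : ℚ) / 2⌋ = ((N / 2 : ℕ) : ℤ) := by
  rw [← natFloor_div_two, Int.natCast_floor_eq_floor (by positivity)]

theorem le_mul_sub_one_of_add_div_le {q w K : ℕ} (hq : 2 ≤ q) (h : w + K / q ≤ K) :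
    (q : ℤ) * w ≤ (K + 1) * ((q : ℤ) - 1) := by
  have h1 := Nat.div_add_mod K q
  have h2 := Nat.mod_lt K (by omega : 0 < q)
  have h3 : q * (w + K / q) ≤ q * K := Nat.mul_le_mul_left _ h
  zify at h1 h2 h3
  nlinarith

theorem ceil_add_lambdaTerm_le_of_add_div_le {q p s r h K : ℕ} (hq : 2 ≤ q)
    (hK : h + (sSet q p s r h).ncard + K / q ≤ K) :
    ⌈(q : ℚ) * h / ((q : ℚ) - 1)⌉ + lambdaTerm q p s r h ≤ K + 1 := by
  have h1 := le_mul_sub_one_of_add_div_le hq hK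
  unfold lambdaTerm
  set c := (sSet q p s r h).ncard
  have hq1 : (0 : ℚ) < (q : ℚ) - 1 := by
    have : (2 : ℚ) ≤ q := by exact_mod_cast hq
    linarith
  have h2 : (q : ℚ) * h / ((q : ℚ) - 1) + (q : ℚ) * c / ((q : ℚ) - 1) ≤ K + 1 := by
    rw [← add_div, div_le_iff₀ hq1]
    have : ((q : ℚ)) * ((h + c : ℕ) : ℚ) ≤ (K + 1) * ((q : ℚ) - 1) := by exact_mod_cast h1
    push_cast at this
    linarith
  -- Each ceiling loses less than 1, so the two together are at most `K + 2`; the `-1` in `Λ`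
  -- absorbs the excess.
  have h3 := Int.ceil_lt_add_one ((q : ℚ) * h / ((q : ℚ) - 1))
  have h4 := Int.ceil_lt_add_one ((q : ℚ) * c / ((q : ℚ) - 1))
  have h5 : ((⌈(q : ℚ) * h / ((q : ℚ) - 1)⌉ + ⌈(q : ℚ) * c / ((q : ℚ) - 1)⌉ : ℤ) : ℚ) <
      ((K + 3 : ℤ) : ℚ) := by
    push_cast
    linarith
  have h6 := Int.cast_lt.1 h5
  omega

/-- Among the residues before a first uncovered leader of size `p`, the `h` smaller leaders and the
elements of `S_p` are counted apart. -/
theorem ceil_add_lambdaTerm_le_of_rank {q n r p s h k : ℕ} (hr0 : 0 < r) (hr : r ∣ q - 1)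
    (hp : p.Prime) (hq : 2 ≤ q) (hs : 0 < s) (hM : n * r * s = q ^ p - 1)
    (hh : h ≤ ((cosetLeaders q n r p).filter fun j => j < 1 + k * r).card) :
    ⌈(q : ℚ) * h / ((q : ℚ) - 1)⌉ + lambdaTerm q p s r h ≤ k + 1 := by
  have hMd : n * r ∣ q ^ p - 1 := ⟨s, hM.symm⟩
  have hq1 : (0 : ℚ) < (q : ℚ) - 1 := by
    have : (2 : ℚ) ≤ q := by exact_mod_cast hq
    linarith
  set W := (cosetLeaders q n r p).filter fun j => j < 1 + k * r with hW
  have hWp : ∀ x ∈ W, ¬ q ∣ x ∧ ∃ m < k, x = 1 + m * r := by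
    intro x hx
    obtain ⟨hx1, hx2⟩ := Finset.mem_filter.1 hx
    exact ⟨not_dvd_of_mem_cosetLeaders hr0 hp.pos hq hMd hx1,
      exists_eq_of_mem_zSet_lt (mem_cosetLeaders.1 hx1).1 hx2⟩
  -- The leaders alone give this bound. It ensures that the cutoff `1 + (D - 2) * r` in `S_p`, with
  -- `D` this ceiling, lies below `1 + k * r`.
  have hD : ⌈(q : ℚ) * h / ((q : ℚ) - 1)⌉ ≤ (k : ℤ) + 1 := by
    rw [Int.ceil_le, div_le_iff₀ hq1]
    have h1 := card_add_div_le (by omega) hr hWp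
    have h2 := le_mul_sub_one_of_add_div_le hq ((Nat.add_le_add_right hh _).trans h1)
    exact_mod_cast h2
  obtain ⟨X, hXc, hX⟩ := exists_finset_card_eq_ncard_sSet (h := h) hr0 hq hM hs
  have hdisj : Disjoint W X := by
    rw [Finset.disjoint_left]
    exact fun x hxW hxX => (hX x hxX).2.2 p (Finset.mem_filter.1 hxW).1
  apply ceil_add_lambdaTerm_le_of_add_div_le hq
  have h1 := card_add_div_le (K := k) (X := W ∪ X) (by omega) hr ?_
  · rw [Finset.card_union_of_disjoint hdisj, hXc] at h1
    omega
  · intro x hx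
    rcases Finset.mem_union.1 hx with hx | hx
    · exact hWp x hx
    · obtain ⟨hx1, ⟨m, -, hm, hmD⟩, -⟩ := hX x hx
      exact ⟨hx1, m, by omega, hm⟩

/-- Used when the missing leader has size 1: then `k ≥ n / 2`, whereas the designed distance is at
most about `3 * N / 4` if `S_p` is empty and twice that otherwise. In the latter case `p ≥ 3`, so `n
≥ 3 * N` compensates. -/
theorem ceil_add_lambdaTerm_le_of_two_le {q n r p s N₁ N h k : ℕ} (hr0 : 0 < r) (hr : r ∣ q - 1)
    (hp : p.Prime) (hq : 3 ≤ q) (hs : 0 < s) (hM : n * r * s = q ^ p - 1)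
    (hn : n = N₁ + p * N) (hN₁ : 2 ≤ N₁) (hh : 2 * h ≤ N + 1) (hk : n ≤ 2 * k) :
    ⌈(q : ℚ) * h / ((q : ℚ) - 1)⌉ + lambdaTerm q p s r h ≤ k + 1 := by
  have hq3 : (3 : ℚ) ≤ q := by exact_mod_cast hq
  have hq1 : (0 : ℚ) < (q : ℚ) - 1 := by linarith
  obtain ⟨X, hXc, hX⟩ := exists_finset_card_eq_ncard_sSet (h := h) hr0 (by omega) hM hs
  have hS2 : p = 2 → (sSet q p s r h).ncard = 0 := by
    rintro rfl
    rw [sSet_two (by omega) hs, Set.ncard_empty]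
  unfold lambdaTerm
  set c := (sSet q p s r h).ncard with hc
  set D := ⌈(q : ℚ) * h / ((q : ℚ) - 1)⌉ with hD
  have hD2 : 4 * D ≤ 3 * N + 5 := by
    have h1 : (q : ℚ) * h / ((q : ℚ) - 1) ≤ 3 * h / 2 := by
      rw [div_le_div_iff₀ hq1 (by norm_num)]
      have : (0 : ℚ) ≤ h := by positivity
      nlinarith
    have h2 : (D : ℚ) < 3 * h / 2 + 1 :=
      (Int.ceil_lt_add_one _).trans_le (by linarith)
    have h3 : ((2 * D : ℤ) : ℚ) < ((3 * h + 2 : ℤ) : ℚ) := by push_cast; linarith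
    have h4 := Int.cast_lt.1 h3
    omega
  have hpN : 2 * N ≤ p * N := Nat.mul_le_mul_right _ hp.two_le
  rcases Nat.eq_zero_or_pos c with hc0 | hcpos
  · rw [hc0]
    simp only [Nat.cast_zero, mul_zero, zero_div, Int.ceil_zero]
    omega
  · have hp3 : 3 ≤ p := by
      have := hp.two_le
      by_contra hlt
      have := hS2 (by omega)
      omega
    have hpN3 : 3 * N ≤ p * N := Nat.mul_le_mul_right _ hp3
    obtain ⟨x₀, hx₀⟩ := Finset.card_pos.1 (hXc.symm ▸ hcpos)
    obtain ⟨-, ⟨m₀, hm₀, -, hm₀D⟩, -⟩ := hX x₀ hx₀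
    obtain ⟨E, hE⟩ : ∃ E : ℕ, D = E + 2 := ⟨(D - 2).toNat, by omega⟩
    -- Counting the residue 1 along with `X` gains the unit that brings the ceiling down to `E + 1`.
    have h1 := card_add_div_le (K := E + 1) (q := q) (r := r) (X := insert 1 X) (by omega) hr ?_
    · rw [Finset.card_insert_of_notMem, hXc] at h1
      · have h2 := Nat.div_add_mod (E + 1) q
        have h3 := Nat.mod_lt (E + 1) (by omega : 0 < q)
        have h4 : q * (c + 1 + (E + 1) / q) ≤ q * (E + 1) := Nat.mul_le_mul_left _ h1
        have h5 : (q : ℚ) * c < (E + 1) * ((q : ℚ) - 1) := by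
          have : (q : ℤ) * c < (E + 1) * ((q : ℤ) - 1) := by
            zify at h2 h3 h4
            nlinarith
          exact_mod_cast this
        have h6 : ⌈(q : ℚ) * c / ((q : ℚ) - 1)⌉ ≤ (E : ℤ) + 1 := by
          rw [Int.ceil_le, div_le_iff₀ hq1]
          push_cast
          exact h5.le
        omega
      · intro h1X
        obtain ⟨-, ⟨m, hm, hm1, -⟩, -⟩ := hX 1 h1X
        have : 0 < m * r := Nat.mul_pos hm hr0
        omega
    · intro x hx
      rcases Finset.mem_insert.1 hx with rfl | hx
      · refine ⟨fun hd => ?_, 0, by omega, by simp⟩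
        have := Nat.le_of_dvd one_pos hd
        omega
      · obtain ⟨hx1, ⟨m, -, hm, hmD⟩, -⟩ := hX x hx
        exact ⟨hx1, m, by omega, hm⟩

theorem card_filter_lt_lt_card {s : Finset ℕ} {x : ℕ} (hx : x ∈ s) :
    (s.filter fun j => j < x).card < s.card :=
  Finset.card_lt_card
    (Finset.ssubset_iff_of_subset (Finset.filter_subset _ _) |>.2 ⟨x, hx, by simp⟩)

theorem gcd_div_le_sub_one {q n r : ℕ} (hr0 : 0 < r) (hr : r ∣ q - 1) (hq : 2 ≤ q) :
    Nat.gcd n ((q - 1) / r) ≤ q - 1 := by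
  have h1 : 0 < (q - 1) / r := Nat.div_pos (Nat.le_of_dvd (by omega) hr) hr0
  exact (Nat.le_of_dvd h1 (Nat.gcd_dvd_right _ _)).trans (Nat.div_le_self _ _)

theorem ceil_add_lambdaTerm_le {q n r p s k : ℕ} (hr0 : 0 < r) (hr : r ∣ q - 1)
    (hp : p.Prime) (hq : 2 ≤ q) (hs : 0 < s) (hM : n * r * s = q ^ p - 1) (hk : k < n)
    (hco : Nat.gcd r (n * r / Nat.gcd (n * r) (q - 1)) = 1)
    (hkT : 1 + k * r ∉ firstCosets q n r 1 (((cosetLeaders q n r 1).card + 1) / 2) ∪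
      firstCosets q n r p (((cosetLeaders q n r p).card + 1) / 2))
    (hmin : ∀ m < k, 1 + m * r ∈ firstCosets q n r 1 (((cosetLeaders q n r 1).card + 1) / 2) ∪
      firstCosets q n r p (((cosetLeaders q n r p).card + 1) / 2)) :
    ⌈(q : ℚ) * (((cosetLeaders q n r p).card + 1) / 2 : ℕ) / ((q : ℚ) - 1)⌉ +
      lambdaTerm q p s r (((cosetLeaders q n r p).card + 1) / 2) ≤ k + 1 := by
  have hMd : n * r ∣ q ^ p - 1 := ⟨s, hM.symm⟩
  have hn : 0 < n := by omega
  rcases mem_cosetLeaders_of_first_missing hr0 hr hp hq hk hMd hkT hmin with ⟨hx, hrank⟩ | ⟨-, hrank⟩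
  · have hN1 := card_cosetLeaders_one hr0 hr hp hq hn hMd hco
    have hlt := card_filter_lt_lt_card hx
    have hsp := rank_mul_le hr0 hp hq hn hMd hco hx hrank
    have hprod := div_gcd_mul_gcd (n := n) hr0 hr
    rw [← hN1] at hprod
    have hN2 : 2 ≤ (cosetLeaders q n r 1).card := by omega
    have hq3 := gcd_div_le_sub_one (n := n) hr0 hr hq
    rw [← hN1] at hq3
    refine ceil_add_lambdaTerm_le_of_two_le hr0 hr hp (by omega) hs hM
      (card_cosetLeaders_add hr0 (modEq_one_of_dvd_sub_one (by omega) hr) hp (by omega) hn hMd)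
      hN2 (Nat.mul_div_le _ _) ?_
    set m := n * r / Nat.gcd (n * r) (q - 1)
    set A := ((cosetLeaders q n r 1).card + 1) / 2 with hA
    rw [Nat.add_sub_cancel_left, ← mul_assoc] at hsp
    have h1 := Nat.le_of_mul_le_mul_right hsp hr0
    have h2 : m * (cosetLeaders q n r 1).card ≤ m * (2 * A) := Nat.mul_le_mul_left _ (by omega)
    have h3 : m * (2 * A) = 2 * (A * m) := by ring
    omega
  · exact ceil_add_lambdaTerm_le_of_rank hr0 hr hp hq hs hM hrank

theorem floor_le_of_mul_lt {q N k : ℕ} (hq : 2 ≤ q) (h : q * N < 2 * (q - 1) * (k + 2)) :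
    ⌊(q : ℚ) * N / (2 * ((q : ℚ) - 1))⌋ ≤ (k : ℤ) + 1 := by
  have hq1 : (0 : ℚ) < (q : ℚ) - 1 := by
    have : (2 : ℚ) ≤ q := by exact_mod_cast hq
    linarith
  rw [← Int.lt_add_one_iff, Int.floor_lt, div_lt_iff₀ (by linarith)]
  have h1 : ((q * N : ℕ) : ℚ) < ((2 * (q - 1) * (k + 2) : ℕ) : ℚ) := by exact_mod_cast h
  push_cast [Nat.cast_sub (by omega : 1 ≤ q)] at h1 ⊢
  linarith

theorem mul_lt_of_rank {q n r p N k : ℕ} (hr0 : 0 < r) (hr : r ∣ q - 1)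
    (hp : p.Prime) (hq : 2 ≤ q) (hM : n * r ∣ q ^ p - 1)
    (hx : 1 + k * r ∈ cosetLeaders q n r p)
    (hN : N / 2 ≤ ((cosetLeaders q n r p).filter fun j => j < 1 + k * r).card) :
    q * N < 2 * (q - 1) * (k + 2) := by
  have h1 := card_add_div_le (K := k + 1)
    -- The missing leader itself is also not a multiple of `q`; it makes up for rounding `N / 2`
    -- down.
    (X := insert (1 + k * r) ((cosetLeaders q n r p).filter fun j => j < 1 + k * r))
    (by omega) hr ?_
  · rw [Finset.card_insert_of_notMem (by simp)] at h1
    have h2 := Nat.div_add_mod (k + 1) q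
    have h3 := Nat.mod_lt (k + 1) (by omega : 0 < q)
    have h4 : q * (N / 2 + 1 + (k + 1) / q) ≤ q * (k + 1) := Nat.mul_le_mul_left _ (by omega)
    have h5 : q * N ≤ q * (2 * (N / 2) + 1) := Nat.mul_le_mul_left _ (by omega)
    zify [(by omega : 1 ≤ q)] at h2 h3 h4 h5 ⊢
    nlinarith
  · intro x hx'
    rcases Finset.mem_insert.1 hx' with rfl | hx'
    · exact ⟨not_dvd_of_mem_cosetLeaders hr0 hp.pos hq hM hx, k, by omega, rfl⟩
    · obtain ⟨hx1, hx2⟩ := Finset.mem_filter.1 hx'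
      obtain ⟨m, hm, he⟩ := exists_eq_of_mem_zSet_lt (mem_cosetLeaders.1 hx1).1 hx2
      exact ⟨not_dvd_of_mem_cosetLeaders hr0 hp.pos hq hM hx1, m, by omega, he⟩

/-- For `q ≥ 4`, `N₁ ≤ 3 * (N₁ / 2)` gives `n ≤ 3 * k`; for `q = 3` necessarily `N₁ = 2` and `n ≤ 2
* k`. -/
theorem mul_lt_of_two_le {q n p N₁ N m k : ℕ} (hp : 2 ≤ p) (hq : 2 ≤ q) (hn : n = N₁ + p * N)
    (hN₁ : 2 ≤ N₁) (hNq : N₁ ≤ q - 1) (hm : m * N₁ = n) (hk : N₁ / 2 * m ≤ k) :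
    q * N < 2 * (q - 1) * (k + 2) := by
  have hpN : 2 * N ≤ p * N := Nat.mul_le_mul_right _ hp
  obtain ⟨Q, rfl⟩ : ∃ Q, q = Q + 1 := ⟨q - 1, by omega⟩
  rw [Nat.add_sub_cancel] at hNq ⊢
  rcases Nat.lt_or_ge Q 3 with hQ | hQ
  · obtain rfl : Q = 2 := by omega
    obtain rfl : N₁ = 2 := by omega
    omega
  · have h1 : m * N₁ ≤ m * (3 * (N₁ / 2)) := Nat.mul_le_mul_left _ (by omega)
    have h2 : m * (3 * (N₁ / 2)) = 3 * (N₁ / 2 * m) := by ring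
    have h3 : 2 * N ≤ 3 * k := by omega
    have h4 : Q * (2 * N) ≤ Q * (3 * k) := Nat.mul_le_mul_left _ h3
    have h5 : 3 * N ≤ Q * N := Nat.mul_le_mul_right _ hQ
    nlinarith

theorem mul_lt_of_eq_one {q r p N k : ℕ} (hr0 : 0 < r) (hr : r ∣ q - 1) (hp : 2 ≤ p) (hq : 2 ≤ q)
    (hk : p * N ≤ k * r) (h : q * r ≤ 2 * p * (q - 1) ∨ r ≤ 3) :
    q * N < 2 * (q - 1) * (k + 2) := by
  have hqr : q * r ≤ 2 * p * (q - 1) := by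
    rcases h with h | h
    · exact h
    -- For `r ≤ 3` the inequality of case (2) is automatic: `p ≥ 2` and `r ≤ q - 1` give `q * r ≤ 4
    -- * (q - 1)`.
    · obtain ⟨Q, rfl⟩ : ∃ Q, q = Q + 1 := ⟨q - 1, by omega⟩
      rw [Nat.add_sub_cancel] at hr ⊢
      have h1 : 4 * Q ≤ 2 * p * Q := Nat.mul_le_mul_right _ (by omega)
      have h2 := Nat.le_of_dvd (by omega) hr
      refine le_trans ?_ h1
      interval_cases r <;> omega
  obtain ⟨Q, rfl⟩ : ∃ Q, q = Q + 1 := ⟨q - 1, by omega⟩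
  rw [Nat.add_sub_cancel] at hqr ⊢
  have h1 : (Q + 1) * r * N ≤ 2 * p * Q * N := Nat.mul_le_mul_right _ hqr
  have h2 : 2 * Q * (p * N) ≤ 2 * Q * (k * r) := Nat.mul_le_mul_left _ hk
  have h3 : (Q + 1) * N * r ≤ 2 * Q * k * r := by nlinarith
  have h4 := Nat.le_of_mul_le_mul_right h3 hr0
  nlinarith

theorem floor_le {q n r p k : ℕ} (hr0 : 0 < r) (hr : r ∣ q - 1)
    (hp : p.Prime) (hq : 2 ≤ q) (hM : n * r ∣ q ^ p - 1) (hk : k < n)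
    (hco : Nat.gcd r (n * r / Nat.gcd (n * r) (q - 1)) = 1)
    (hcase : 1 < (cosetLeaders q n r 1).card ∨
      ((cosetLeaders q n r 1).card = 1 ∧ q * r ≤ 2 * p * (q - 1)) ∨ r ≤ 3)
    (hkT : 1 + k * r ∉ firstCosets q n r 1 ((cosetLeaders q n r 1).card / 2) ∪
      firstCosets q n r p ((cosetLeaders q n r p).card / 2))
    (hmin : ∀ m < k, 1 + m * r ∈ firstCosets q n r 1 ((cosetLeaders q n r 1).card / 2) ∪
      firstCosets q n r p ((cosetLeaders q n r p).card / 2)) :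
    ⌊(q : ℚ) * (cosetLeaders q n r p).card / (2 * ((q : ℚ) - 1))⌋ ≤ (k : ℤ) + 1 := by
  have hn : 0 < n := by omega
  apply floor_le_of_mul_lt hq
  rcases mem_cosetLeaders_of_first_missing hr0 hr hp hq hk hM hkT hmin with
    ⟨hx, hrank⟩ | ⟨hx, hrank⟩
  · have hN1 := card_cosetLeaders_one hr0 hr hp hq hn hM hco
    have hsp := rank_mul_le hr0 hp hq hn hM hco hx hrank
    have hprod := div_gcd_mul_gcd (n := n) hr0 hr
    have hsum := card_cosetLeaders_add hr0 (modEq_one_of_dvd_sub_one (by omega) hr) hp (by omega)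
      hn hM
    have hxd := ((mem_cosetLeaders_one hr0 hp hq hn hM).1 hx).2
    have hpos : 0 < (cosetLeaders q n r 1).card := Finset.card_pos.2 ⟨_, hx⟩
    rcases Nat.lt_or_ge 1 (cosetLeaders q n r 1).card with h2 | h2
    · have hNq := gcd_div_le_sub_one (n := n) hr0 hr hq
      rw [← hN1] at hprod hNq
      rw [Nat.add_sub_cancel_left, ← mul_assoc] at hsp
      exact mul_lt_of_two_le hp.two_le hq hsum h2 hNq hprod (Nat.le_of_mul_le_mul_right hsp hr0)
    -- Now `m = n`, so `n` divides the fixed point `1 + k * r`, and `p * N_p = n - 1 ≤ k * r`.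
    · have h1 : (cosetLeaders q n r 1).card = 1 := by omega
      rw [← hN1, h1, mul_one] at hprod
      rw [hprod] at hxd
      have hle := Nat.le_of_dvd (by omega) hxd
      refine mul_lt_of_eq_one hr0 hr hp.two_le hq (by omega) ?_
      rcases hcase with h | h | h
      · omega
      · exact Or.inl h.2
      · exact Or.inr h
  · exact mul_lt_of_rank hr0 hr hp hq hM hx hrank

/-! ### Assembling the codes, and infinitely many lengths -/

theorem exists_code_of_firstCosets {F : Type*} [Field F] [Fintype F] [DecidableEq F] {K : Type*}
    [Field K] [Algebra F K] {n r p a b : ℕ} (hr0 : 0 < r) (hr : r ∣ Fintype.card F - 1)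
    (hn : 0 < n) (hp : p.Prime) (hM : n * r ∣ Fintype.card F ^ p - 1) {lam : F} {β : K}
    (hβ : IsPrimitiveRoot β (n * r)) (hlam : β ^ n = algebraMap F K lam) (hlr : lam ^ r = 1)
    (ha : a ≤ (cosetLeaders (Fintype.card F) n r 1).card)
    (hb : b ≤ (cosetLeaders (Fintype.card F) n r p).card) {d : ℤ}
    (hd : ∀ k < n,
      1 + k * r ∉ firstCosets (Fintype.card F) n r 1 a ∪ firstCosets (Fintype.card F) n r p b →
      (∀ m < k,
        1 + m * r ∈ firstCosets (Fintype.card F) n r 1 a ∪ firstCosets (Fintype.card F) n r p b) →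
      d ≤ k + 1) :
    ∃ C : Submodule F (Fin n → F), IsConstacyclic lam C ∧
      definingSet r β C =
        ↑(firstCosets (Fintype.card F) n r 1 a ∪ firstCosets (Fintype.card F) n r p b) ∧
      HasParams C ((n : ℤ) - (a : ℕ) - p * (b : ℕ)) d := by
  have hq : 0 < Fintype.card F := Fintype.card_pos
  have hqr := modEq_one_of_dvd_sub_one hq hr
  set T := firstCosets (Fintype.card F) n r 1 a ∪ firstCosets (Fintype.card F) n r p b with hTdef
  have hTZ : T ⊆ zSet n r :=
    Finset.union_subset (firstCosets_subset_zSet hr0 hqr) (firstCosets_subset_zSet hr0 hqr)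
  have hT : ∀ x ∈ T, cycCoset (Fintype.card F) (n * r) x ⊆ T := by
    intro x hx
    rcases Finset.mem_union.1 hx with h | h
    · exact (cycCoset_subset_firstCosets hp.pos hq hM h).trans Finset.subset_union_left
    · exact (cycCoset_subset_firstCosets hp.pos hq hM h).trans Finset.subset_union_right
  have hTcard : T.card = a + p * b := by
    rw [hTdef, Finset.card_union_of_disjoint (disjoint_firstCosets hr0 hp.pos hq hM hp.one_lt.ne),
      card_firstCosets hr0 hp.pos hq hM ha, card_firstCosets hr0 hp.pos hq hM hb, mul_one,
      mul_comm b]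
  have hTn : T.card ≤ n := (Finset.card_le_card hTZ).trans (card_zSet hr0).le
  obtain ⟨C, hC, hdef, hrank, hdist⟩ := exists_constacyclic_code hr0 hn hβ hlam hlr hTZ hT
  refine ⟨C, hC, hdef, ?_, ?_⟩
  · rw [hrank, Nat.cast_sub hTn, hTcard]
    push_cast
    ring
  · intro x hx y hy hxy
    rcases hdist with h | ⟨k, hk, hkT, hmin, hdist⟩
    -- If `T` is all of `Z_{n,r}`, the code is zero and has no two distinct words.
    · rw [h, card_zSet hr0, Nat.sub_self, Submodule.finrank_eq_zero] at hrank
      rw [hrank, Submodule.mem_bot] at hx hy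
      exact absurd (hx.trans hy.symm) hxy
    · exact (hd k hk hkT hmin).trans (by exact_mod_cast hdist x hx y hy hxy)

/-- If `M` vanished in `K`, then `M * s + 1 = q ^ p` with `q = 0` in `K` would read `1 = 0`. -/
theorem natCast_ne_zero_of_dvd_pow_sub_one {F K : Type*} [Field F] [Fintype F] [Field K]
    [Algebra F K] {M p : ℕ} (hp : 0 < p) (hM : M ∣ Fintype.card F ^ p - 1) : (M : K) ≠ 0 := by
  obtain ⟨s, hs⟩ := hM
  intro h
  have h1 : M * s + 1 = Fintype.card F ^ p := by
    have := Nat.one_le_pow p _ (Fintype.card_pos (α := F))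
    omega
  have h2 : ((Fintype.card F : ℕ) : K) = 0 := by
    rw [← map_natCast (algebraMap F K), FiniteField.cast_card_eq_zero, map_zero]
  have h3 := congrArg (Nat.cast : ℕ → K) h1
  push_cast at h3
  rw [h, h2, zero_mul, zero_pow hp.ne', zero_add] at h3
  exact one_ne_zero h3

theorem pow_sub_one_div_sub_one_modEq {q r p : ℕ} (hq : 2 ≤ q) (hr : r ∣ q - 1) :
    (q ^ p - 1) / (q - 1) ≡ p [MOD r] := by
  rw [← Nat.geomSum_eq hq]
  induction p with
  | zero => simp [Nat.ModEq]
  | succ p ih =>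
    rw [Finset.sum_range_succ]
    simpa using ih.add ((modEq_one_of_dvd_sub_one (by omega) hr).pow p)

theorem infinite_setOf_length {q r : ℕ} (hq : 2 ≤ q) (hr : r ∣ q - 1) :
    {n : ℕ | ∃ p s : ℕ, p.Prime ∧ n * r * s = q ^ p - 1 ∧
      Nat.gcd r (n * r / Nat.gcd (n * r) (q - 1)) = 1 ∧
      (1 < numCosets q n r 1 ∨
        (numCosets q n r 1 = 1 ∧ q * r ≤ 2 * p * (q - 1)) ∨ r ≤ 3)}.Infinite := by
  have hr0 : 0 < r := Nat.pos_of_dvd_of_pos hr (by omega)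
  have hrq : r ≤ q - 1 := Nat.le_of_dvd (by omega) hr
  have hdvd : ∀ p, r ∣ q ^ p - 1 := fun p => hr.trans (Nat.sub_one_dvd_pow_sub_one q p)
  refine Set.Infinite.mono ?_ (Set.infinite_of_injOn_mapsTo (s := {p | p.Prime ∧ q < p})
    (f := fun p => (q ^ p - 1) / r) (t := (fun p => (q ^ p - 1) / r) '' {p | p.Prime ∧ q < p})
    ?_ (Set.mapsTo_image _ _) ?_)
  · rintro _ ⟨p, ⟨hp, hqp⟩, rfl⟩
    have hM : (q ^ p - 1) / r * r = q ^ p - 1 := Nat.div_mul_cancel (hdvd p)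
    have hpow : q ≤ q ^ p := Nat.le_self_pow hp.ne_zero q
    have hn : 0 < (q ^ p - 1) / r :=
      Nat.div_pos (Nat.le_of_dvd (by omega) (hdvd p)) hr0
    have hco : Nat.gcd r ((q ^ p - 1) / r * r / Nat.gcd ((q ^ p - 1) / r * r) (q - 1)) = 1 := by
      rw [hM, Nat.gcd_eq_right (Nat.sub_one_dvd_pow_sub_one q p), Nat.gcd_comm,
        (pow_sub_one_div_sub_one_modEq hq hr).gcd_eq]
      -- The quotient is `≡ p` modulo `r`, and the prime `p` exceeds `q > r`.
      exact (Nat.Prime.coprime_iff_not_dvd hp).2 fun h => by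
        have := Nat.le_of_dvd hr0 h
        omega
    refine ⟨p, 1, hp, by simpa using hM, hco, ?_⟩
    have hMd : (q ^ p - 1) / r * r ∣ q ^ p - 1 := hM.dvd
    have hN : 0 < numCosets q ((q ^ p - 1) / r) r 1 := by
      rw [numCosets_eq_card_cosetLeaders hr0 (modEq_one_of_dvd_sub_one (by omega) hr) hp.pos
        (by omega) hMd, card_cosetLeaders_one hr0 hr hp hq hn hMd hco]
      exact Nat.gcd_pos_of_pos_left _ hn
    rcases Nat.lt_or_ge 1 (numCosets q ((q ^ p - 1) / r) r 1) with h | h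
    · exact Or.inl h
    · refine Or.inr (Or.inl ⟨le_antisymm h hN, ?_⟩)
      exact Nat.mul_le_mul (by omega : q ≤ 2 * p) hrq
  · intro a _ b _ hab
    have h1 := Nat.div_mul_cancel (hdvd a)
    have h2 := Nat.div_mul_cancel (hdvd b)
    simp only at hab
    rw [hab] at h1
    have h3 := Nat.one_le_pow a q (by omega)
    have h4 := Nat.one_le_pow b q (by omega)
    exact Nat.pow_right_injective hq (by simp only; omega)
  · rw [Set.infinite_iff_exists_gt]
    intro m
    obtain ⟨p, hp1, hp2⟩ := Nat.exists_infinite_primes (max q m + 1)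
    exact ⟨p, ⟨hp2, by omega⟩, by omega⟩

theorem theorem4 (F : Type*) [Field F] [Fintype F] [DecidableEq F] (q r : ℕ) (hq : Fintype.card F = q)
    (hr : r ∣ q - 1) :
    (∀ p n s : ℕ, p.Prime → n * r * s = q ^ p - 1 →
      Nat.gcd r (n * r / Nat.gcd (n * r) (q - 1)) = 1 →
      numCosets q n r 1 = Nat.gcd n ((q - 1) / r) ∧
      (numCosets q n r p : ℚ) = ((n : ℚ) - (Nat.gcd n ((q - 1) / r) : ℚ)) / p ∧
      ∀ lam : F, orderOf lam = r →
        (∃ β : AlgebraicClosure F, IsPrimitiveRoot β (n * r) ∧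
          β ^ n = algebraMap F (AlgebraicClosure F) lam) ∧
        ∀ β : AlgebraicClosure F, IsPrimitiveRoot β (n * r) →
          β ^ n = algebraMap F (AlgebraicClosure F) lam →
          (∃ C : Submodule F (Fin n → F),
            IsConstacyclic lam C ∧
            definingSet r β C =
              ↑(firstCosets q n r 1 ⌈(numCosets q n r 1 : ℚ) / 2⌉₊ ∪
                firstCosets q n r p ⌈(numCosets q n r p : ℚ) / 2⌉₊) ∧
            HasParams C
              ((n : ℤ) - ⌈(numCosets q n r 1 : ℚ) / 2⌉ - p * ⌈(numCosets q n r p : ℚ) / 2⌉)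
              (⌈(q : ℚ) * (⌈(numCosets q n r p : ℚ) / 2⌉ : ℚ) / ((q : ℚ) - 1)⌉ +
                lambdaTerm q p s r ⌈(numCosets q n r p : ℚ) / 2⌉₊)) ∧
          ((1 < numCosets q n r 1 ∨
            (numCosets q n r 1 = 1 ∧ q * r ≤ 2 * p * (q - 1)) ∨
            r ≤ 3) →
            ∃ C : Submodule F (Fin n → F),
              IsConstacyclic lam C ∧
              definingSet r β C =
                ↑(firstCosets q n r 1 ⌊(numCosets q n r 1 : ℚ) / 2⌋₊ ∪
                  firstCosets q n r p ⌊(numCosets q n r p : ℚ) / 2⌋₊) ∧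
              HasParams C
                ((n : ℤ) - ⌊(numCosets q n r 1 : ℚ) / 2⌋ - p * ⌊(numCosets q n r p : ℚ) / 2⌋)
                ⌊(q : ℚ) * numCosets q n r p / (2 * ((q : ℚ) - 1))⌋)) ∧
    {n : ℕ | ∃ p s : ℕ, p.Prime ∧ n * r * s = q ^ p - 1 ∧
      Nat.gcd r (n * r / Nat.gcd (n * r) (q - 1)) = 1 ∧
      (1 < numCosets q n r 1 ∨
        (numCosets q n r 1 = 1 ∧ q * r ≤ 2 * p * (q - 1)) ∨ r ≤ 3)}.Infinite := by

  subst hq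
  have hq : 2 ≤ Fintype.card F := Fintype.one_lt_card
  have hr0 : 0 < r := Nat.pos_of_dvd_of_pos hr (by omega)
  have hqr := modEq_one_of_dvd_sub_one (by omega) hr
  refine ⟨?_, infinite_setOf_length hq hr⟩
  intro p n s hp hM hco
  have hpow : Fintype.card F ≤ Fintype.card F ^ p := Nat.le_self_pow hp.ne_zero _
  have hpos : 0 < n * r * s := by omega
  have hs : 0 < s := Nat.pos_of_mul_pos_left hpos
  have hn : 0 < n := Nat.pos_of_mul_pos_right (Nat.pos_of_mul_pos_right hpos)
  have hMd : n * r ∣ Fintype.card F ^ p - 1 := ⟨s, hM.symm⟩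
  have hN : ∀ l, numCosets (Fintype.card F) n r l = (cosetLeaders (Fintype.card F) n r l).card :=
    fun l => numCosets_eq_card_cosetLeaders hr0 hqr hp.pos (by omega) hMd
  have hN1 := card_cosetLeaders_one hr0 hr hp hq hn hMd hco
  have hsum := card_cosetLeaders_add hr0 hqr hp (by omega) hn hMd
  rw [hN 1, hN p]
  refine ⟨hN1, ?_, ?_⟩
  · rw [← hN1, eq_div_iff (by exact_mod_cast hp.ne_zero), eq_sub_iff_add_eq]
    have : (n : ℚ) = _ := congrArg Nat.cast hsum
    rw [this]
    push_cast
    ring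
  intro lam hlam
  have hprim : IsPrimitiveRoot lam r := hlam ▸ IsPrimitiveRoot.orderOf lam
  refine ⟨exists_isPrimitiveRoot_pow_eq (natCast_ne_zero_of_dvd_pow_sub_one (F := F) hp.pos hMd)
    (hprim.map_of_injective (algebraMap F (AlgebraicClosure F)).injective), ?_⟩
  intro β hβ hβn
  rw [natCeil_div_two, natCeil_div_two, natFloor_div_two, natFloor_div_two, ceil_div_two,
    ceil_div_two, floor_div_two, floor_div_two, Int.cast_natCast]
  refine ⟨?_, fun hcase => ?_⟩
  · exact exists_code_of_firstCosets hr0 hr hn hp hMd hβ hβn hprim.pow_eq_one (by omega) (by omega)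
      fun k hk hkT hmin => ceil_add_lambdaTerm_le hr0 hr hp hq hs hM hk hco hkT hmin
  · exact exists_code_of_firstCosets hr0 hr hn hp hMd hβ hβn hprim.pow_eq_one (by omega) (by omega)
      fun k hk hkT hmin => floor_le hr0 hr hp hq hMd hk hco hcase hkT hmin
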